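/- **Conventions.** Let $\mathcal C$ be a small category equipped with an ordinal-valued degree function $\deg$ on its objects. For an ordinal $\delta$, let $\mathcal C_\delta\subseteq\mathcal C$ be the full subcategory of objects of degree $<\delta$, with inclusion $\iota_\delta$. For weights $W:\mathcal D\to\mathrm{Set}$, $U:\mathcal D^{\mathrm{op}}\to\mathrm{Set}$ and a diagram $X:\mathcal D\to\mathcal M$, write $\{W,X\}^{\mathcal D}$ for the $W$-weighted limit and $U\otimes_{\mathcal D}X$ for the $U$-weighted colimit. For $A\in\mathcal M^{\mathcal C}$ and $x\in\mathcal C$ of degree $\delta$, the matching and latching objects are $$M_xA=\{\mathcal C(x,-),\iota_\delta^*A\}^{\mathcal C_\delta},\qquad L_xA=\mathcal C(-,x)\otimes_{\mathcal C_\delta}\iota_\delta^*A ,$$ with canonical maps $L_xA\to A_x\to M_xA$. *Abstract bigluing data* from a category $\mathcal B$ to a category $\mathcal D$ consist of functors $U:\mathcal B^{\mathrm{op}}\times\mathcal D\to\mathrm{Set}$ and $W:\mathcal D^{\mathrm{op}}\times\mathcal B\to\mathrm{Set}$ and maps $\alpha:W(d,b')\times U(b,d)\to\mathcal B(b,b')$,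 natural in $b,b'$ and dinatural in $d$. Their *collage* is the category whose objects are those of $\mathcal B$ and of $\mathcal D$ (disjoint union), with hom-sets $\mathcal B(b,b')$ from $b$ to $b'$, $U(b,d)$ from $b$ to $d$, $W(d,b)$ from $d$ to $b$, and $\mathcal D(d,d')\sqcup(U\otimes_{\mathcal B}W)(d,d')$ from $d$ to $d'$, with composition induced by the given structure. $\mathcal C$ is *bistratified with discrete strata* (with respect to $\deg$) if for every ordinal $\delta$ the inclusion $\mathcal C_\delta\to\mathcal C_{\delta+1}$ is isomorphic, under $\mathcal C_\delta$, to the inclusion of $\mathcal C_\delta$ in the collage of some abstract bigluing data from $\mathcal C_\delta$ to a discrete category. For a category $\mathcal D$ with degree function, $X\in\mathrm{Set}^{\mathcal D}$ is an *$\mathcal L$-object* if the map $A=\emptyset\to X$ is such that $L_yX\sqcup_{L_yA}A_y\to X_y$ is injective for all $y\in\mathcal D$. $\mathcal C$ is *almost-Reedy* if it is bistratified with discrete strata and, for every object $x$ of degree $\beta$, the functors $\mathcal C(x,-)\in\mathrm{Set}^{\mathcal C_\beta}$ and $\mathcal C(-,x)\in\mathrm{Set}^{\mathcal C_\beta^{\mathrm{op}}}$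 are $\mathcal L$-objects ($\mathcal C_\beta$ and $\mathcal C_\beta^{\mathrm{op}}$ carrying the degrees of $\mathcal C$). **Theorem.** Let $\mathcal C$ be almost-Reedy. Then for any model category $\mathcal M$ (complete and cocomplete), the functor category $\mathcal M^{\mathcal C}$ has a model structure such that * $A\to B$ is a weak equivalence iff $A_x\to B_x$ is a weak equivalence in $\mathcal M$ for all $x\in\mathcal C$; * $A\to B$ is a fibration (resp. acyclic fibration) iff for all $x\in\mathcal C$ the induced map $A_x\to M_xA\times_{M_xB}B_x$ is a fibration (resp. acyclic fibration) in $\mathcal M$; * $A\to B$ is a cofibration (resp. acyclic cofibration) iff for all $x\in\mathcal C$ the induced map $L_xB\sqcup_{L_xA}A_x\to B_x$ is a cofibration (resp. acyclic cofibration) in $\mathcal M$. -/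

import Mathlib

open CategoryTheory CategoryTheory.Limits Opposite HomotopicalAlgebra

universe t v w u

/-- Abstract bigluing data from `C` to `D`: profunctors `U : D ⇸ C` and `W : C ⇸ D` and a map of
profunctors `α : W ⊗_D U ⟶ C(-, -)`. A profunctor `C ⇸ D` is a functor `Dᵒᵖ × C ⥤ Type`, and the
elements of `U(c, d)`, resp. `W(d, c)`, play the role of arrows `c ⟶ d`, resp. `d ⟶ c`.
The map out of the coend `W ⊗_D U` is given by its components `W(d, c') × U(c, d) → C(c, c')`,
natural in `c` and `c'` and balanced in `d`. -/
structure BigluingData (C D : Type u) [Category.{u} C] [Category.{u} D] where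
  U : Profunctor.{u} D C
  W : Profunctor.{u} C D
  α {c c' : C} {d : D} (p : (U.obj d).obj (op c)) (q : (W.obj c').obj (op d)) : c ⟶ c'
  α_precomp {c₀ c c' : C} {d : D} (f : c₀ ⟶ c) (p : (U.obj d).obj (op c))
    (q : (W.obj c').obj (op d)) : α ((U.obj d).map f.op p) q = f ≫ α p q
  α_postcomp {c c' c₁ : C} {d : D} (p : (U.obj d).obj (op c)) (q : (W.obj c').obj (op d))
    (g : c' ⟶ c₁) : α p ((W.map g).app (op d) q) = α p q ≫ g
  α_balanced {c c' : C} {d d' : D} (p : (U.obj d).obj (op c)) (k : d ⟶ d')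
    (q : (W.obj c').obj (op d')) : α ((U.map k).app (op c) p) q = α p ((W.obj c').map k.op q)

namespace BigluingData

variable {C D : Type u} [Category.{u} C] [Category.{u} D] (B : BigluingData C D)

/-- The set `U(c, d)`. -/
abbrev HomU (c : C) (d : D) : Type u := (B.U.obj d).obj (op c)
/-- The set `W(d, c)`. -/
abbrev HomW (d : D) (c : C) : Type u := (B.W.obj c).obj (op d)

section

variable {B}

/-- Action of an arrow of `C` on `U`. -/
def preU {c c' : C} {d : D} (f : c ⟶ c') (p : B.HomU c' d) : B.HomU c d := (B.U.obj d).map f.op p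
/-- Action of an arrow of `D` on `U`. -/
def postU {c : C} {d d' : D} (p : B.HomU c d) (k : d ⟶ d') : B.HomU c d' := (B.U.map k).app (op c) p
/-- Action of an arrow of `D` on `W`. -/
def preW {d d' : D} {c : C} (k : d ⟶ d') (q : B.HomW d' c) : B.HomW d c := (B.W.obj c).map k.op q
/-- Action of an arrow of `C` on `W`. -/
def postW {d : D} {c c' : C} (q : B.HomW d c) (f : c ⟶ c') : B.HomW d c' := (B.W.map f).app (op d) q

@[simp] lemma preU_id {c : C} {d : D} (p : B.HomU c d) : preU (𝟙 c) p = p := by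
  simp [preU]
@[simp] lemma postU_id {c : C} {d : D} (p : B.HomU c d) : postU p (𝟙 d) = p := by
  simp [postU]
@[simp] lemma preW_id {d : D} {c : C} (q : B.HomW d c) : preW (𝟙 d) q = q := by
  simp [preW]
@[simp] lemma postW_id {d : D} {c : C} (q : B.HomW d c) : postW q (𝟙 c) = q := by
  simp [postW]
@[simp] lemma preU_comp {c c' c'' : C} {d : D} (f : c ⟶ c') (g : c' ⟶ c'') (p : B.HomU c'' d) :
    preU (f ≫ g) p = preU f (preU g p) := by
  simp [preU]
@[simp] lemma postU_comp {c : C} {d d' d'' : D} (p : B.HomU c d) (k : d ⟶ d') (l : d' ⟶ d'') :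
    postU p (k ≫ l) = postU (postU p k) l := by
  simp [postU]
@[simp] lemma preW_comp {d d' d'' : D} {c : C} (k : d ⟶ d') (l : d' ⟶ d'') (q : B.HomW d'' c) :
    preW (k ≫ l) q = preW k (preW l q) := by
  simp [preW]
@[simp] lemma postW_comp {d : D} {c c' c'' : C} (q : B.HomW d c) (f : c ⟶ c') (g : c' ⟶ c'') :
    postW q (f ≫ g) = postW (postW q f) g := by
  simp [postW]
@[simp] lemma preU_postU {c c' : C} {d d' : D} (f : c ⟶ c') (p : B.HomU c' d) (k : d ⟶ d') :
    postU (preU f p) k = preU f (postU p k) := by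
  exact (B.U.map k).naturality_apply f.op p
@[simp] lemma preW_postW {c c' : C} {d d' : D} (k : d ⟶ d') (q : B.HomW d' c) (f : c ⟶ c') :
    postW (preW k q) f = preW k (postW q f) := by
  exact (B.W.map f).naturality_apply k.op q
@[simp] lemma α_preU {c₀ c c' : C} {d : D} (f : c₀ ⟶ c) (p : B.HomU c d) (q : B.HomW d c') :
    B.α (preU f p) q = f ≫ B.α p q := B.α_precomp f p q
@[simp] lemma α_postW {c c' c₁ : C} {d : D} (p : B.HomU c d) (q : B.HomW d c') (g : c' ⟶ c₁) :
    B.α p (postW q g) = B.α p q ≫ g := B.α_postcomp p q g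
@[simp] lemma α_postU {c c' : C} {d d' : D} (p : B.HomU c d) (k : d ⟶ d') (q : B.HomW d' c') :
    B.α (postU p k) q = B.α p (preW k q) := B.α_balanced p k q

end

/-- The relation `(q, p ∘ k) ∼ (k ∘ q, p)` whose quotient is the tensor product. -/
inductive TensorRel (d d' : D) :
    (Σ c : C, B.HomW d c × B.HomU c d') → (Σ c : C, B.HomW d c × B.HomU c d') → Prop
  | slide {c c' : C} (q : B.HomW d c) (k : c ⟶ c') (p : B.HomU c' d') :
      TensorRel d d' ⟨c, q, preU k p⟩ ⟨c', postW q k, p⟩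

/-- The tensor product `(U ⊗_C W)(d, d')`: formal composites `d ⟶ c ⟶ d'` with `c` in `C`,
modulo the equivalence relation generated by `TensorRel`. -/
def Tensor (d d' : D) : Type u := Quot (B.TensorRel d d')

namespace Tensor
variable {B}

/-- The class of a formal composite. -/
def mk {d d' : D} {c : C} (q : B.HomW d c) (p : B.HomU c d') : B.Tensor d d' :=
  Quot.mk _ ⟨c, q, p⟩

@[simp] lemma mk_preU {d d' : D} {c c' : C} (q : B.HomW d c) (k : c ⟶ c') (p : B.HomU c' d') :
    mk q (preU k p) = mk (postW q k) p :=
  Quot.sound (.slide q k p)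

/-- Maps out of the tensor product. -/
def lift {d d' : D} {T : Type u} (φ : ∀ c : C, B.HomW d c → B.HomU c d' → T)
    (hφ : ∀ (c c' : C) (q : B.HomW d c) (k : c ⟶ c') (p : B.HomU c' d'),
      φ c q (preU k p) = φ c' (postW q k) p) : B.Tensor d d' → T :=
  Quot.lift (fun t ↦ φ t.1 t.2.1 t.2.2) (by rintro _ _ ⟨q, k, p⟩; exact hφ _ _ q k p)

@[simp] lemma lift_mk {d d' : D} {T : Type u} (φ : ∀ c : C, B.HomW d c → B.HomU c d' → T)
    (hφ) {c : C} (q : B.HomW d c) (p : B.HomU c d') : lift φ hφ (mk q p) = φ c q p := rfl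

lemma exists_rep {d d' : D} (t : B.Tensor d d') :
    ∃ (c : C) (q : B.HomW d c) (p : B.HomU c d'), t = mk q p := by
  obtain ⟨⟨c, q, p⟩⟩ := t
  exact ⟨c, q, p, rfl⟩

end Tensor

/-- Objects of the collage: the disjoint union of the objects of `C` and of `D`. -/
inductive Collage (B : BigluingData C D) : Type u
  | left (c : C)
  | right (d : D)

namespace Collage

/-- Arrows of the collage: `C(c, c')`, `U(c, d)`, `W(d, c)`, and the disjoint union
of `D(d, d')` and `(U ⊗_C W)(d, d')`. -/
inductive Hom : B.Collage → B.Collage → Type u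
  | ll {c c' : C} (f : c ⟶ c') : Hom (.left c) (.left c')
  | lr {c : C} {d : D} (p : B.HomU c d) : Hom (.left c) (.right d)
  | rl {d : D} {c : C} (q : B.HomW d c) : Hom (.right d) (.left c)
  | rr {d d' : D} (k : d ⟶ d') : Hom (.right d) (.right d')
  | tensor {d d' : D} (t : B.Tensor d d') : Hom (.right d) (.right d')

/-- Identities of the collage. -/
def id : ∀ X : B.Collage, Hom B X X
  | .left c => .ll (𝟙 c)
  | .right d => .rr (𝟙 d)

variable {B} in
/-- Composition in the collage; composites `c ⟶ d ⟶ c'` are evaluated by `α`. -/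
def comp : ∀ {X Y Z : B.Collage}, Hom B X Y → Hom B Y Z → Hom B X Z
  | _, _, _, .ll f, .ll g => .ll (f ≫ g)
  | _, _, _, .ll f, .lr p => .lr (preU f p)
  | _, _, _, .lr p, .rl q => .ll (B.α p q)
  | _, _, _, .lr p, .rr k => .lr (postU p k)
  | _, _, _, .lr p, .tensor t =>
      .lr (t.lift (fun _ q p' ↦ preU (B.α p q) p') (by simp))
  | _, _, _, .rl q, .ll f => .rl (postW q f)
  | _, _, _, .rl q, .lr p => .tensor (.mk q p)
  | _, _, _, .rr k, .rl q => .rl (preW k q)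
  | _, _, _, .rr k, .rr l => .rr (k ≫ l)
  | _, _, _, .rr k, .tensor t =>
      .tensor (t.lift (fun _ q p ↦ .mk (preW k q) p) (by simp))
  | _, _, _, .tensor t, .rl q =>
      .rl (t.lift (fun _ q' p ↦ postW q' (B.α p q)) (by simp))
  | _, _, _, .tensor t, .rr k =>
      .tensor (t.lift (fun _ q p ↦ .mk q (postU p k)) (by simp))
  | _, _, _, .tensor t, .tensor s =>
      .tensor (t.lift (fun _ q p ↦ s.lift (fun _ q' p' ↦ .mk (postW q (B.α p q')) p')
        (by simp)) (by simp))

instance : Category.{u} B.Collage where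
  Hom := Hom B
  id := id B
  comp := comp
  id_comp f := by
    rcases f with f | p | q | k | t
    all_goals try obtain ⟨c, q, p, rfl⟩ := t.exists_rep
    all_goals simp [id, comp]
  comp_id f := by
    rcases f with f | p | q | k | t
    all_goals try obtain ⟨c, q, p, rfl⟩ := t.exists_rep
    all_goals simp [id, comp]
  assoc f g h := by
    rcases f with f | p | q | k | t <;> rcases g with f' | p' | q' | k' | t' <;>
      rcases h with f'' | p'' | q'' | k'' | t''
    all_goals try obtain ⟨c, q, p, rfl⟩ := t.exists_rep
    all_goals try obtain ⟨c', q', p', rfl⟩ := t'.exists_rep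
    all_goals try obtain ⟨c'', q'', p'', rfl⟩ := t''.exists_rep
    all_goals simp [comp]

/-- The inclusion of `C` in the collage. -/
def inclusion : C ⥤ B.Collage where
  obj := .left
  map f := Hom.ll f

end Collage
end BigluingData

section Degree

variable {C : Type u} [Category.{u} C] (deg : C → Ordinal.{t})

/-- The objects of degree `< δ`. -/
abbrev degreeLT (δ : Ordinal.{t}) : ObjectProperty C := fun x ↦ deg x < δ

/-- The full subcategory `C_δ` of the objects of degree `< δ`. -/
abbrev Below (δ : Ordinal.{t}) : Type u := (degreeLT deg δ).FullSubcategory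

/-- The inclusion `ι_δ : C_δ ⥤ C`. -/
abbrev Below.ι (δ : Ordinal.{t}) : Below deg δ ⥤ C := (degreeLT deg δ).ι

/-- `C`, with the degree function `deg`, is bistratified with discrete strata: for every ordinal
`δ`, the category `C_{δ+1}` is isomorphic, under `C_δ`, to the collage of some abstract bigluing
data from `C_δ` to a discrete category. The objects added at this step are then exactly those of
degree `δ`. At the bottom `C_0` is empty, and at limit ordinals `δ` the category `C_δ` is the union
(colimit) of the `C_γ` for `γ < δ`, since all of them are full subcategories of `C`; similarly
`C` itself is `C_β` for any `β` larger than all the degrees (the height). -/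
def IsBistratifiedDiscrete : Prop :=
  ∀ δ : Ordinal.{t}, ∃ (I : Type u) (B : BigluingData (Below deg δ) (Discrete I))
    (Φ : B.Collage ⥤ Below deg (δ + 1)),
    Φ.Full ∧ Φ.Faithful ∧ Function.Bijective Φ.obj ∧
      BigluingData.Collage.inclusion B ⋙ Φ ⋙ Below.ι deg (δ + 1) = Below.ι deg δ

end Degree

section WeightedColimit

variable {C : Type u} [Category.{u} C] {M : Type w} [Category.{v} M] [HasColimitsOfSize.{u, u} M]

/-- The weighted colimit `U ⊗_C X` for a weight `U : Cᵒᵖ ⥤ Type u`, as the colimit of `X` over the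
category of elements of `U`; this is dual to Mathlib's `Functor.weightedLimObjObj`. -/
noncomputable def weightedColim (U : Cᵒᵖ ⥤ Type u) (X : C ⥤ M) : M :=
  colimit ((CategoryOfElements.π U).leftOp ⋙ X)

/-- The coprojections `X c ⟶ U ⊗_C X` for `p : U c`. -/
noncomputable def weightedColim.ι (U : Cᵒᵖ ⥤ Type u) (X : C ⥤ M) {c : C} (p : U.obj (op c)) :
    X.obj c ⟶ weightedColim U X :=
  colimit.ι ((CategoryOfElements.π U).leftOp ⋙ X) (op (U.elementsMk (op c) p))

/-- Functoriality of the weighted colimit in the diagram. -/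
noncomputable def weightedColim.map (U : Cᵒᵖ ⥤ Type u) {X Y : C ⥤ M} (f : X ⟶ Y) :
    weightedColim U X ⟶ weightedColim U Y :=
  colimMap (Functor.whiskerLeft _ f)

lemma weightedColim.ι_map (U : Cᵒᵖ ⥤ Type u) {X Y : C ⥤ M} (f : X ⟶ Y) {c : C}
    (p : U.obj (op c)) :
    weightedColim.ι U X p ≫ weightedColim.map U f = f.app c ≫ weightedColim.ι U Y p := by
  exact ι_colimMap _ _

/-- Maps out of the weighted colimit. -/
noncomputable def weightedColim.desc (U : Cᵒᵖ ⥤ Type u) (X : C ⥤ M) {Z : M}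
    (φ : ∀ ⦃c : C⦄, U.obj (op c) → (X.obj c ⟶ Z))
    (hφ : ∀ ⦃c c' : C⦄ (k : c ⟶ c') (p : U.obj (op c')), φ (U.map k.op p) = X.map k ≫ φ p) :
    weightedColim U X ⟶ Z :=
  colimit.desc ((CategoryOfElements.π U).leftOp ⋙ X)
    { pt := Z
      ι :=
        { app := fun e ↦ φ e.unop.2
          naturality := fun e e' k ↦ by
            have h := hφ k.unop.val.unop e'.unop.2
            rw [Quiver.Hom.op_unop, k.unop.property] at h
            exact h.symm.trans (Category.comp_id _).symm } }

lemma weightedColim.ι_desc (U : Cᵒᵖ ⥤ Type u) (X : C ⥤ M) {Z : M}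
    (φ : ∀ ⦃c : C⦄, U.obj (op c) → (X.obj c ⟶ Z)) (hφ) {c : C} (p : U.obj (op c)) :
    weightedColim.ι U X p ≫ weightedColim.desc U X φ hφ = φ p := by
  exact colimit.ι_desc _ _

lemma weightedColim.hom_ext {U : Cᵒᵖ ⥤ Type u} {X : C ⥤ M} {Z : M}
    {f g : weightedColim U X ⟶ Z}
    (h : ∀ (c : C) (p : U.obj (op c)), weightedColim.ι U X p ≫ f = weightedColim.ι U X p ≫ g) :
    f = g :=
  colimit.hom_ext fun e ↦ h e.unop.1.unop e.unop.2

end WeightedColimit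

section Reedy

variable {C : Type u} [Category.{u} C] (deg : C → Ordinal.{t}) {M : Type w} [Category.{v} M]

section Matching

variable [HasLimitsOfSize.{u, u} M] (x : C)

/-- The weight `C(x, -)` on `C_δ`. -/
abbrev homFrom (δ : Ordinal.{t}) : Below deg δ ⥤ Type u := Below.ι deg δ ⋙ coyoneda.obj (op x)

/-- The matching object `M_x A`: the limit of the restriction of `A` to `C_δ`, `δ = deg x`,
weighted by `C(x, -)`. -/
noncomputable abbrev matchingObj (A : C ⥤ M) : M :=
  (homFrom deg x (deg x)).weightedLimObjObj (Below.ι deg (deg x) ⋙ A)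

/-- The map `M_x A ⟶ M_x B` induced by `A ⟶ B`. -/
noncomputable def matchingMap {A B : C ⥤ M} (f : A ⟶ B) :
    matchingObj deg x A ⟶ matchingObj deg x B :=
  (homFrom deg x (deg x)).weightedLimObjMap (Functor.whiskerLeft (Below.ι deg (deg x)) f)

/-- The canonical map `A_x ⟶ M_x A`, whose component at `g : x ⟶ y` is `A g`. -/
noncomputable def toMatching (A : C ⥤ M) : A.obj x ⟶ matchingObj deg x A :=
  ((homFrom deg x (deg x)).isLimitWeightedLimCone (Below.ι deg (deg x) ⋙ A)).lift
    (fun _ g ↦ A.map g) (fun _ _ g k ↦ by simp)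

lemma toMatching_π (A : C ⥤ M) {y : Below deg (deg x)} (g : x ⟶ y.obj) :
    toMatching deg x A ≫
      (homFrom deg x (deg x)).weightedLimObjObjπ (Below.ι deg (deg x) ⋙ A) (j := y) g =
    A.map g := by
  unfold toMatching
  exact Functor.isLimitWeightedLimCone_fac (homFrom deg x (deg x)) (Below.ι deg (deg x) ⋙ A) _ _
    (j := y) g

lemma toMatching_naturality {A B : C ⥤ M} (f : A ⟶ B) :
    toMatching deg x A ≫ matchingMap deg x f = f.app x ≫ toMatching deg x B := by
  apply Functor.weightedLimObjObj.hom_ext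
  intro y g
  rw [matchingMap, Category.assoc, Category.assoc, Functor.weightedLimObjMap_π, toMatching_π,
    ← Category.assoc, toMatching_π]
  exact f.naturality g

/-- The relative matching map `A_x ⟶ M_x A ×_{M_x B} B_x`. -/
noncomputable def relMatching [HasPullbacks M] {A B : C ⥤ M} (f : A ⟶ B) :
    A.obj x ⟶ pullback (matchingMap deg x f) (toMatching deg x B) :=
  pullback.lift (toMatching deg x A) (f.app x) (toMatching_naturality deg x f)

end Matching

section Latching

variable [HasColimitsOfSize.{u, u} M] (x : C)

/-- The weight `C(-, x)` on `C_δ`. -/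
abbrev homTo (δ : Ordinal.{t}) : (Below deg δ)ᵒᵖ ⥤ Type u := (Below.ι deg δ).op ⋙ yoneda.obj x

/-- The latching object `L_x A`: the colimit of the restriction of `A` to `C_δ`, `δ = deg x`,
weighted by `C(-, x)`. -/
noncomputable abbrev latchingObj (A : C ⥤ M) : M :=
  weightedColim (homTo deg x (deg x)) (Below.ι deg (deg x) ⋙ A)

/-- The map `L_x A ⟶ L_x B` induced by `A ⟶ B`. -/
noncomputable def latchingMap {A B : C ⥤ M} (f : A ⟶ B) :
    latchingObj deg x A ⟶ latchingObj deg x B :=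
  weightedColim.map (homTo deg x (deg x)) (Functor.whiskerLeft (Below.ι deg (deg x)) f)

/-- The canonical map `L_x A ⟶ A_x`, whose component at `g : y ⟶ x` is `A g`. -/
noncomputable def fromLatching (A : C ⥤ M) : latchingObj deg x A ⟶ A.obj x :=
  weightedColim.desc (homTo deg x (deg x)) (Below.ι deg (deg x) ⋙ A)
    (fun _ g ↦ A.map g) (fun _ _ k g ↦ by simp)

lemma ι_fromLatching (A : C ⥤ M) {y : Below deg (deg x)} (g : y.obj ⟶ x) :
    weightedColim.ι (homTo deg x (deg x)) (Below.ι deg (deg x) ⋙ A) (c := y) g ≫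
      fromLatching deg x A = A.map g := by
  unfold fromLatching
  exact weightedColim.ι_desc (homTo deg x (deg x)) (Below.ι deg (deg x) ⋙ A) _ _ (c := y) g

lemma fromLatching_naturality {A B : C ⥤ M} (f : A ⟶ B) :
    latchingMap deg x f ≫ fromLatching deg x B = fromLatching deg x A ≫ f.app x := by
  apply weightedColim.hom_ext
  intro y g
  rw [latchingMap, ← Category.assoc, ← Category.assoc, weightedColim.ι_map, ι_fromLatching,
    Category.assoc, ι_fromLatching]
  exact (f.naturality g).symm

/-- The relative latching map `L_x B ⊔_{L_x A} A_x ⟶ B_x`. -/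
noncomputable def relLatching [HasPushouts M] {A B : C ⥤ M} (f : A ⟶ B) :
    pushout (latchingMap deg x f) (fromLatching deg x A) ⟶ B.obj x :=
  pushout.desc (fromLatching deg x B) (f.app x) (fromLatching_naturality deg x f)

end Latching

/-- The left class of the Reedy weak factorization system on `Set^C` induced by
(injections, surjections): the maps whose relative latching maps are injective. -/
def reedyInjections : MorphismProperty (C ⥤ Type u) :=
  fun _ _ f ↦ ∀ x : C, Function.Injective (relLatching deg x f)

/-- `X` is an `L`-object of `Set^C` if `∅ ⟶ X` is in the left class of the Reedy weak factorization
system. -/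
def IsReedyLObject (X : C ⥤ Type u) : Prop :=
  reedyInjections deg (initial.to X)

/-- `C`, with the degree function `deg`, is almost-Reedy: it is bistratified with discrete strata,
and for every object `x` of degree `β` the functors `C(x, -)` on `C_β` and `C(-, x)` on `C_βᵒᵖ`
are `L`-objects (`C_β` and `C_βᵒᵖ` having the same degrees as `C`). -/
structure IsAlmostReedy : Prop where
  bistratified : IsBistratifiedDiscrete deg
  homFrom_isReedyLObject (x : C) :
    IsReedyLObject (fun y : Below deg (deg x) ↦ deg y.obj) (homFrom deg x (deg x))
  homTo_isReedyLObject (x : C) :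
    IsReedyLObject (fun y : (Below deg (deg x))ᵒᵖ ↦ deg y.unop.obj) (homTo deg x (deg x))

end Reedy

/-!
As `C` is bistratified with discrete strata, a diagram on the objects of degree `< δ` extends to an
object `x` of degree `δ` by the choice of a factorization `L_x ⟶ A_x ⟶ M_x` of the canonical map:
an arrow between two distinct objects of degree `δ` factors through lower degree, in an essentially
unique way. Hence a weak factorization system on `M`, applied to the maps from relative latching to
relative matching objects by transfinite induction on the degree, gives one on `C ⥤ M`.

The trivial classes have to be compared with the levelwise weak equivalences. If the relative
latching maps of `f` in degrees `< deg x` are trivial cofibrations, then so is `L_x f`: a lift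
against a fibration is built on the arrows `y ⟶ x` by induction on `deg y`. At an arrow which
factors through an object of degree `< deg y` the lift is forced, and that `C(-, x)` is an
`L`-object says that all such factorizations are connected, so that it is well defined.
-/

namespace BigluingData.Collage

variable {C D : Type u} [Category.{u} C] [Category.{u} D] {B : BigluingData C D}

lemma exists_rl {d : D} {c : C} (k : (right d : B.Collage) ⟶ left c) : ∃ q, k = Hom.rl q :=
  match k with
  | .rl q => ⟨q, rfl⟩

lemma exists_lr {d : D} {c : C} (k : (left c : B.Collage) ⟶ right d) : ∃ p, k = Hom.lr p :=
  match k with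
  | .lr p => ⟨p, rfl⟩

lemma exists_rr_or_tensor {d d' : D} (k : (right d : B.Collage) ⟶ right d') :
    (∃ m, k = Hom.rr m) ∨ ∃ (c : C) (q : B.HomW d c) (p : B.HomU c d'),
      k = Hom.tensor (.mk q p) := by
  match k with
  | .rr m => exact .inl ⟨m, rfl⟩
  | .tensor t =>
    obtain ⟨c, q, p, rfl⟩ := t.exists_rep
    exact .inr ⟨c, q, p, rfl⟩

end BigluingData.Collage

section Factorizations

variable {C : Type u} [Category.{u} C] {deg : C → Ordinal.{t}}

lemma degreeLT_mono : Monotone (degreeLT deg) := fun _ _ h _ hx ↦ hx.trans_le h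

lemma degreeLT_le {δ : Ordinal.{t}} (x : C) (hx : degreeLT deg δ x) :
    degreeLT deg (deg x) ≤ degreeLT deg δ :=
  degreeLT_mono hx.le

variable (deg) in
/-- Any two factorizations of an arrow `x ⟶ y` through objects of degree `< δ` are connected by a
zigzag of factorizations. In the encoding, zigzags are replaced by the predicates `φ` which do not
distinguish the factorizations of `k ≫ m ≫ l` through the source and through the target of `m`. -/
def LowFactorizationsConnected (δ : Ordinal.{t}) (x y : C) : Prop :=
  ∀ φ : ∀ ⦃z : C⦄, deg z < δ → (x ⟶ z) → (z ⟶ y) → Prop,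
    (∀ ⦃z z' : C⦄ (hz : deg z < δ) (hz' : deg z' < δ) (k : x ⟶ z) (m : z ⟶ z') (l : z' ⟶ y),
      φ hz k (m ≫ l) ↔ φ hz' (k ≫ m) l) →
    ∀ ⦃z z' : C⦄ (hz : deg z < δ) (hz' : deg z' < δ) (k : x ⟶ z) (l : z ⟶ y) (k' : x ⟶ z')
      (l' : z' ⟶ y), k ≫ l = k' ≫ l' → φ hz k l → φ hz' k' l'

namespace LowFactorizationsConnected

variable {δ : Ordinal.{t}} {x y : C}

lemma eq_of_comp_eq (h : LowFactorizationsConnected deg δ x y) {T : Sort*}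
    (φ : ∀ ⦃z : C⦄, deg z < δ → (x ⟶ z) → (z ⟶ y) → T)
    (hφ : ∀ ⦃z z' : C⦄ (hz : deg z < δ) (hz' : deg z' < δ) (k : x ⟶ z) (m : z ⟶ z')
      (l : z' ⟶ y), φ hz k (m ≫ l) = φ hz' (k ≫ m) l)
    ⦃z z' : C⦄ (hz : deg z < δ) (hz' : deg z' < δ) (k : x ⟶ z) (l : z ⟶ y) (k' : x ⟶ z')
    (l' : z' ⟶ y) (e : k ≫ l = k' ≫ l') : φ hz k l = φ hz' k' l' :=
  h (fun _ hw k' l' ↦ φ hz k l = φ hw k' l') (fun _ _ hw hw' k' m l' ↦ by rw [hφ hw hw'])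
    hz hz' k l k' l' e rfl

lemma of_source_lt (hx : deg x < δ) : LowFactorizationsConnected deg δ x y := by
  intro φ hφ z z' hz hz' k l k' l' e h
  rw [← Category.id_comp k, ← hφ hx, e, hφ hx hz', Category.id_comp] at h
  exact h

lemma of_target_lt (hy : deg y < δ) : LowFactorizationsConnected deg δ x y := by
  intro φ hφ z z' hz hz' k l k' l' e h
  rw [← Category.comp_id l, hφ hz hy, e, ← hφ hz' hy, Category.comp_id] at h
  exact h

end LowFactorizationsConnected

namespace IsBistratifiedDiscrete

variable (h : IsBistratifiedDiscrete deg)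

include h

lemma exists_collage (δ : Ordinal.{t}) :
    ∃ (I : Type u) (B : BigluingData (Below deg δ) (Discrete I)) (Ψ : B.Collage ⥤ C),
      Ψ.Full ∧ Ψ.Faithful ∧ (∀ c, deg (Ψ.obj (.left c)) < δ) ∧
      (∀ z, deg z < δ → ∃ c, Ψ.obj (.left c) = z) ∧
      (∀ z, deg z = δ → ∃ i, Ψ.obj (.right i) = z) := by
  obtain ⟨I, B, Φ, _, _, hΦ, e⟩ := h δ
  have hl (c) : (Φ.obj (.left c)).obj = c.obj := Functor.congr_obj e c
  refine ⟨I, B, Φ ⋙ Below.ι deg (δ + 1), inferInstance, inferInstance,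
    fun c ↦ (congrArg deg (hl c)).trans_lt c.property, fun z hz ↦ ⟨⟨z, hz⟩, hl _⟩, fun z hz ↦ ?_⟩
  obtain ⟨c | i, hc⟩ := hΦ.surjective ⟨z, by simp [degreeLT, hz]⟩
  · have hcz : z = c.obj := by rw [← hl, hc]
    exact absurd c.property (by simp [degreeLT, ← hcz, hz])
  · exact ⟨i, congrArg (·.obj) hc⟩

lemma comp_ne_id {x z : C} (hz : deg z < deg x) (k : x ⟶ z) (l : z ⟶ x) : k ≫ l ≠ 𝟙 x := by
  obtain ⟨I, B, Ψ, _, _, -, hl, hr⟩ := h.exists_collage (deg x)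
  obtain ⟨i, hi⟩ := hr x rfl
  obtain ⟨c, rfl⟩ := hl z hz
  generalize deg x = δ at *
  subst hi
  obtain ⟨k, rfl⟩ := Ψ.map_surjective k
  obtain ⟨l, rfl⟩ := Ψ.map_surjective l
  obtain ⟨q, rfl⟩ := BigluingData.Collage.exists_rl k
  obtain ⟨p, rfl⟩ := BigluingData.Collage.exists_lr l
  intro H
  rw [← Ψ.map_comp, ← Ψ.map_id] at H
  cases Ψ.map_injective H

lemma eq_or_exists_factorization {δ : Ordinal.{t}} {x y : C} (hx : deg x ≤ δ) (hy : deg y ≤ δ)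
    (k : x ⟶ y) : (∃ e : x = y, k = eqToHom e) ∨
      ∃ (z : C) (k₁ : x ⟶ z) (k₂ : z ⟶ y), deg z < δ ∧ k₁ ≫ k₂ = k := by
  obtain hx | hx := hx.lt_or_eq
  · exact .inr ⟨x, 𝟙 x, k, hx, Category.id_comp k⟩
  obtain hy | hy := hy.lt_or_eq
  · exact .inr ⟨y, k, 𝟙 y, hy, Category.comp_id k⟩
  obtain ⟨I, B, Ψ, _, _, hlt, -, hr⟩ := h.exists_collage δ
  obtain ⟨i, rfl⟩ := hr x hx
  obtain ⟨j, rfl⟩ := hr y hy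
  obtain ⟨k, rfl⟩ := Ψ.map_surjective k
  obtain ⟨m, rfl⟩ | ⟨c, q, p, rfl⟩ := BigluingData.Collage.exists_rr_or_tensor k
  · obtain rfl : i = j := Discrete.ext (Discrete.eq_of_hom m)
    obtain rfl : m = 𝟙 i := Subsingleton.elim _ _
    exact .inl ⟨rfl, Ψ.map_id (.right i)⟩
  · exact .inr ⟨Ψ.obj (.left c), Ψ.map (.rl q), Ψ.map (.lr p), hlt c, (Ψ.map_comp _ _).symm⟩

lemma lowFactorizationsConnected_of_eq {δ : Ordinal.{t}} {x y : C} (hx : deg x = δ)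
    (hy : deg y = δ) : LowFactorizationsConnected deg δ x y := by
  obtain ⟨I, B, Ψ, _, _, hlt, hl, hr⟩ := h.exists_collage δ
  obtain ⟨i, rfl⟩ := hr x hx
  obtain ⟨j, rfl⟩ := hr y hy
  intro φ hφ
  let ψ : B.Tensor i j → ULift Prop :=
    BigluingData.Tensor.lift (fun c q p ↦ ⟨φ (hlt c) (Ψ.map (.rl q)) (Ψ.map (.lr p))⟩)
      fun c c' q k p ↦ congrArg ULift.up <| propext <| by
        have h := hφ (hlt c) (hlt c') (Ψ.map (.rl q)) (Ψ.map (.ll k)) (Ψ.map (.lr p))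
        rwa [← Ψ.map_comp, ← Ψ.map_comp] at h
  have exists_tensor {z : C} (hz : deg z < δ) (k : Ψ.obj (.right i) ⟶ z)
      (l : z ⟶ Ψ.obj (.right j)) :
      ∃ t : B.Tensor i j, k ≫ l = Ψ.map (.tensor t) ∧ φ hz k l = (ψ t).down := by
    obtain ⟨c, rfl⟩ := hl z hz
    obtain ⟨k, rfl⟩ := Ψ.map_surjective k
    obtain ⟨l, rfl⟩ := Ψ.map_surjective l
    obtain ⟨q, rfl⟩ := BigluingData.Collage.exists_rl k
    obtain ⟨p, rfl⟩ := BigluingData.Collage.exists_lr l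
    exact ⟨.mk q p, (Ψ.map_comp _ _).symm, rfl⟩
  intro z z' hz hz' k l k' l' e
  obtain ⟨t, ht, hφt⟩ := exists_tensor hz k l
  obtain ⟨t', ht', hφt'⟩ := exists_tensor hz' k' l'
  rw [ht, ht'] at e
  obtain rfl : t = t' := by injection Ψ.map_injective e
  rw [hφt, hφt']
  exact id

lemma lowFactorizationsConnected {δ : Ordinal.{t}} {x y : C} (hx : deg x ≤ δ) (hy : deg y ≤ δ) :
    LowFactorizationsConnected deg δ x y := by
  obtain hx | hx := hx.lt_or_eq
  · exact .of_source_lt hx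
  obtain hy | hy := hy.lt_or_eq
  · exact .of_target_lt hy
  exact h.lowFactorizationsConnected_of_eq hx hy

end IsBistratifiedDiscrete

lemma isEmpty_initial_obj (x : C) : IsEmpty ((⊥_ (C ⥤ Type u)).obj x) :=
  ⟨fun a ↦ PEmpty.elim ((initial.to ((Functor.const C).obj PEmpty.{u + 1})).app x a)⟩

lemma IsReedyLObject.fromLatching_injective {X : C ⥤ Type u} (h : IsReedyLObject deg X) (x : C) :
    Function.Injective (fromLatching deg x X) := by
  have hE (y : C) := isEmpty_initial_obj y
  let r : pushout (latchingMap deg x (initial.to X)) (fromLatching deg x (⊥_ (C ⥤ Type u))) ⟶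
      latchingObj deg x X :=
    pushout.desc (𝟙 _) (↾ fun a ↦ (hE x).elim a) (by
      apply weightedColim.hom_ext
      intro c p
      ext a
      exact (hE c.obj).elim a)
  have inl_injective : Function.Injective (pushout.inl (latchingMap deg x (initial.to X))
      (fromLatching deg x (⊥_ (C ⥤ Type u)))) :=
    Function.LeftInverse.injective (g := r) fun a ↦
      ConcreteCategory.congr_hom (show pushout.inl _ _ ≫ r = 𝟙 _ from pushout.inl_desc _ _ _) a
  have inl_relLatching :
      pushout.inl _ _ ≫ relLatching deg x (initial.to X) = fromLatching deg x X :=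
    pushout.inl_desc _ _ _
  rw [← inl_relLatching]
  exact fun a b hab ↦ inl_injective (h x hab)

/-- An element of the latching object is a formal composite of `a : X z` with an arrow `z ⟶ y`, so
injectivity of `L_y X ⟶ X_y` says that the formal composites with a given value are connected. -/
lemma IsReedyLObject.iff_of_map_eq {X : C ⥤ Type u} (h : IsReedyLObject deg X) {y : C}
    (φ : ∀ ⦃z : C⦄, deg z < deg y → X.obj z → (z ⟶ y) → Prop)
    (hφ : ∀ ⦃z z' : C⦄ (hz : deg z < deg y) (hz' : deg z' < deg y) (a : X.obj z) (m : z ⟶ z')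
      (l : z' ⟶ y), φ hz a (m ≫ l) ↔ φ hz' (X.map m a) l)
    ⦃z z' : C⦄ (hz : deg z < deg y) (hz' : deg z' < deg y) {a : X.obj z} {l : z ⟶ y}
    {a' : X.obj z'} {l' : z' ⟶ y} (e : X.map l a = X.map l' a') : φ hz a l ↔ φ hz' a' l' := by
  let ψ : latchingObj deg y X ⟶ ULift.{u} Prop :=
    weightedColim.desc (homTo deg y (deg y)) (Below.ι deg (deg y) ⋙ X)
      (fun z l ↦ ↾ fun a ↦ ULift.up (φ z.property a l))
      (fun z z' m l ↦ by ext a; exact hφ z.property z'.property a m.hom l)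
  let ι {z : C} (hz : deg z < deg y) (a : X.obj z) (l : z ⟶ y) : latchingObj deg y X :=
    weightedColim.ι (homTo deg y (deg y)) (Below.ι deg (deg y) ⋙ X) (c := ⟨z, hz⟩) l a
  have fromLatching_ι {z : C} (hz : deg z < deg y) (a : X.obj z) (l : z ⟶ y) :
      fromLatching deg y X (ι hz a l) = X.map l a :=
    ConcreteCategory.congr_hom (ι_fromLatching deg y X (y := ⟨z, hz⟩) l) a
  have ψ_ι {z : C} (hz : deg z < deg y) (a : X.obj z) (l : z ⟶ y) :
      ψ (ι hz a l) = ULift.up (φ hz a l) :=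
    ConcreteCategory.congr_hom (weightedColim.ι_desc (homTo deg y (deg y))
      (Below.ι deg (deg y) ⋙ X) _ _ (c := ⟨z, hz⟩) l) a
  have hι : ι hz a l = ι hz' a' l' := h.fromLatching_injective y <| by
    rw [fromLatching_ι, fromLatching_ι, e]
  have hψ : ULift.up (φ hz a l) = ULift.up (φ hz' a' l') := by rw [← ψ_ι, ← ψ_ι, hι]
  rw [ULift.up.inj hψ]

namespace IsAlmostReedy

variable (h : IsAlmostReedy deg)

include h

lemma lowFactorizationsConnected_of_lt {x y : C} (hyx : deg y < deg x) :
    LowFactorizationsConnected deg (deg y) x y := by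
  intro φ hφ z z' hz hz' k l k' l' e
  have hx := (h.homFrom_isReedyLObject x).iff_of_map_eq (y := ⟨y, hyx⟩)
    (fun z hz k l ↦ φ hz k l.hom) (fun _ _ hz hz' k m l ↦ hφ hz hz' k m.hom l.hom)
  exact (hx (z := ⟨z, hz.trans hyx⟩) (z' := ⟨z', hz'.trans hyx⟩) hz hz' (a := k)
    (l := ObjectProperty.homMk l) (a' := k') (l' := ObjectProperty.homMk l') e).mp

lemma lowFactorizationsConnected_of_gt {x y : C} (hxy : deg x < deg y) :
    LowFactorizationsConnected deg (deg x) x y := by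
  intro φ hφ z z' hz hz' k l k' l' e
  have hy := (h.homTo_isReedyLObject y).iff_of_map_eq (y := op ⟨x, hxy⟩)
    (fun z hz l k ↦ φ hz k.unop.hom l)
    (fun _ _ hz hz' l m k ↦ (hφ hz' hz k.unop.hom m.unop.hom l).symm)
  let z₀ (z : C) (hz : deg z < deg x) : Below deg (deg y) := ⟨z, hz.trans hxy⟩
  let k₀ {z : C} (hz : deg z < deg x) (k : x ⟶ z) : (⟨x, hxy⟩ : Below deg (deg y)) ⟶ z₀ z hz :=
    ObjectProperty.homMk k
  exact (hy (z := op (z₀ z hz)) (z' := op (z₀ z' hz')) hz hz' (a := l) (l := (k₀ hz k).op)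
    (a' := l') (l' := (k₀ hz' k').op) e).mp

end IsAlmostReedy

end Factorizations

section CompatibleFamily

variable {C : Type*} [Category* C]

/-- Every arrow between objects of the same degree is an identity or factors through an object of
lower degree. For such a category, a family of structures on its objects that are compatible with
the arrows can be constructed by induction on the degree. -/
def HasLowFactorizations (deg : C → Ordinal.{t}) : Prop :=
  ∀ ⦃x y : C⦄, deg x = deg y → ∀ k : x ⟶ y, (∃ e : x = y, k = eqToHom e) ∨
    ∃ (z : C) (k₁ : x ⟶ z) (k₂ : z ⟶ y), deg z < deg x ∧ k₁ ≫ k₂ = k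

variable {deg : C → Ordinal.{t}} {Fib : C → Type*}
  {Compat : ∀ ⦃x y : C⦄, (x ⟶ y) → Fib x → Fib y → Prop}

/-- The elements obtained by iterating a choice `ext` of extensions of compatible families. -/
inductive IsIteratedExtension
    (ext : ∀ x (s : ∀ y, deg y < deg x → Fib y),
      (∀ ⦃y z⦄ (hy : deg y < deg x) (hz : deg z < deg x) (k : y ⟶ z),
        Compat k (s y hy) (s z hz)) → Fib x) : ∀ x, Fib x → Prop
  | mk {x} (s : ∀ y, deg y < deg x → Fib y) (hs) :
    (∀ y hy, IsIteratedExtension ext y (s y hy)) → IsIteratedExtension ext x (ext x s hs)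

lemma IsIteratedExtension.unique {ext} {x : C} {X X' : Fib x}
    (h : IsIteratedExtension (deg := deg) (Compat := Compat) ext x X)
    (h' : IsIteratedExtension ext x X') : X = X' := by
  induction h with
  | mk s hs _ ih =>
    cases h' with | mk s' hs' hX'
    obtain rfl : s = s' := funext fun y ↦ funext fun hy ↦ ih y hy (hX' y hy)
    rfl

theorem HasLowFactorizations.exists_compatible_family (hdeg : HasLowFactorizations deg)
    (compat_id : ∀ ⦃x⦄ (X : Fib x), Compat (𝟙 x) X X)
    (compat_comp : ∀ ⦃x y z⦄ {k : x ⟶ y} {l : y ⟶ z} {X : Fib x} {Y : Fib y} {Z : Fib z},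
      Compat k X Y → Compat l Y Z → Compat (k ≫ l) X Z)
    (exists_extension : ∀ x (s : ∀ y, deg y < deg x → Fib y),
      (∀ ⦃y z⦄ (hy : deg y < deg x) (hz : deg z < deg x) (k : y ⟶ z),
        Compat k (s y hy) (s z hz)) →
      ∃ X : Fib x, ∀ ⦃y⦄ (hy : deg y < deg x),
        (∀ k : y ⟶ x, Compat k (s y hy) X) ∧ ∀ k : x ⟶ y, Compat k X (s y hy)) :
    ∃ s : ∀ x, Fib x, ∀ ⦃x y⦄ (k : x ⟶ y), Compat k (s x) (s y) := by
  choose ext hext using exists_extension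
  have compat_of_lt {x y} {X : Fib x} {Y : Fib y} (hX : IsIteratedExtension ext x X)
      (hY : IsIteratedExtension ext y Y) (hyx : deg y < deg x) :
      (∀ k : y ⟶ x, Compat k Y X) ∧ ∀ k : x ⟶ y, Compat k X Y := by
    cases hX with | mk s hs hX
    rw [hY.unique (hX y hyx)]
    exact hext x s hs hyx
  have compat {x y} (k : x ⟶ y) {X : Fib x} {Y : Fib y} (hX : IsIteratedExtension ext x X)
      (hY : IsIteratedExtension ext y Y) : Compat k X Y := by
    obtain hxy | hxy | hyx := lt_trichotomy (deg x) (deg y)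
    · exact (compat_of_lt hY hX hxy).1 k
    · obtain ⟨rfl, rfl⟩ | ⟨z, k₁, k₂, hz, rfl⟩ := hdeg hxy k
      · rw [hX.unique hY]
        exact compat_id Y
      · obtain ⟨Z, hZ⟩ : ∃ Z, IsIteratedExtension ext z Z := by
          cases hX with | mk s _ hs
          exact ⟨_, hs z hz⟩
        exact compat_comp ((compat_of_lt hX hZ hz).2 k₁) ((compat_of_lt hY hZ (hxy ▸ hz)).1 k₂)
    · exact (compat_of_lt hX hY hyx).2 k
  have exists_isIteratedExtension (x) : ∃ X, IsIteratedExtension ext x X := by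
    induction x using (InvImage.wf deg wellFounded_lt).induction with
    | _ x ih =>
      choose s hs using ih
      exact ⟨_, .mk s (fun y z hy hz k ↦ compat k (hs y hy) (hs z hz)) hs⟩
  choose s hs using exists_isIteratedExtension
  exact ⟨s, fun x y k ↦ compat k (hs x) (hs y)⟩

end CompatibleFamily

lemma IsBistratifiedDiscrete.hasLowFactorizations {C : Type u} [Category.{u} C]
    {deg : C → Ordinal.{t}} (hC : IsBistratifiedDiscrete deg) : HasLowFactorizations deg :=
  fun _ _ h k ↦ hC.eq_or_exists_factorization le_rfl h.ge k

lemma HasLowFactorizations.below {C : Type u} [Category.{u} C] {deg : C → Ordinal.{t}}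
    (h : HasLowFactorizations deg) (δ : Ordinal.{t}) :
    HasLowFactorizations fun x : Below deg δ ↦ deg x.obj := by
  intro x y hxy k
  obtain ⟨e, hk⟩ | ⟨z, k₁, k₂, hz, hk⟩ := h hxy k.hom
  · obtain ⟨x, hx⟩ := x
    obtain rfl : x = y.obj := e
    exact .inl ⟨rfl, ObjectProperty.hom_ext _ hk⟩
  · exact .inr ⟨⟨z, hz.trans x.property⟩, ObjectProperty.homMk k₁, ObjectProperty.homMk k₂, hz,
      ObjectProperty.hom_ext _ hk⟩

/-- A category displayed over `C`: the objects over `x` form the type `Fib x`. The arrows over `k`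
are encoded as arrows of a fixed category `E`, so that the laws of a category hold in `E` and no
transport along equations between arrows of `C` is needed. -/
structure DisplayedCategory (C : Type*) [Category* C] (E : Type*) [Category* E] where
  Fib : C → Type*
  total {x : C} : Fib x → E
  IsOver {x y : C} (k : x ⟶ y) (X : Fib x) (Y : Fib y) : (total X ⟶ total Y) → Prop
  isOver_id {x : C} (X : Fib x) : IsOver (𝟙 x) X X (𝟙 (total X))
  isOver_comp {x y z : C} {k : x ⟶ y} {l : y ⟶ z} {X : Fib x} {Y : Fib y} {Z : Fib z}
    {φ : total X ⟶ total Y} {ψ : total Y ⟶ total Z} :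
    IsOver k X Y φ → IsOver l Y Z ψ → IsOver (k ≫ l) X Z (φ ≫ ψ)

namespace DisplayedCategory

variable {C : Type*} [Category* C] {E : Type*} [Category* E] (P : DisplayedCategory C E)

/-- The action on arrows of a section of `P` over the objects satisfying `W`, when its action on
objects is given. -/
structure SectionMaps {W : ObjectProperty C} (fib : ∀ x, W x → P.Fib x) where
  map {x y : C} (hx : W x) (hy : W y) (k : x ⟶ y) : P.total (fib x hx) ⟶ P.total (fib y hy)
  isOver {x y : C} (hx : W x) (hy : W y) (k : x ⟶ y) :
    P.IsOver k (fib x hx) (fib y hy) (map hx hy k)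
  map_id {x : C} (hx : W x) : map hx hx (𝟙 x) = 𝟙 (P.total (fib x hx))
  map_comp {x y z : C} (hx : W x) (hy : W y) (hz : W z) (k : x ⟶ y) (l : y ⟶ z) :
    map hx hz (k ≫ l) = map hx hy k ≫ map hy hz l

/-- A section of `P` over the full subcategory of the objects satisfying `W`. -/
structure PartialSection (W : ObjectProperty C) where
  fib (x : C) : W x → P.Fib x
  maps : P.SectionMaps fib

namespace PartialSection

variable {P} {W W' : ObjectProperty C}

/-- The functor to `E` underlying a section of `P`. -/
@[simps]
def functor (s : P.PartialSection W) : W.FullSubcategory ⥤ E where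
  obj x := P.total (s.fib x.obj x.property)
  map {x y} k := s.maps.map x.property y.property k.hom
  map_id _ := s.maps.map_id _
  map_comp _ _ := s.maps.map_comp _ _ _ _ _

/-- The restriction of a section of `P` to a smaller full subcategory. -/
def restrict (s : P.PartialSection W') (h : W ≤ W') : P.PartialSection W where
  fib x hx := s.fib x (h x hx)
  maps :=
    { map hx hy k := s.maps.map (h _ hx) (h _ hy) k
      isOver _ _ _ := s.maps.isOver _ _ _
      map_id _ := s.maps.map_id _
      map_comp _ _ _ _ _ := s.maps.map_comp _ _ _ _ _ }

lemma ext_of_heq {s t : P.PartialSection W} (hfib : ∀ x hx, s.fib x hx = t.fib x hx)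
    (hmap : ∀ {x y} hx hy (k : x ⟶ y), HEq (s.maps.map hx hy k) (t.maps.map hx hy k)) :
    s = t := by
  obtain ⟨fib, ⟨⟩⟩ := s
  obtain ⟨fib', ⟨⟩⟩ := t
  obtain rfl : fib = fib' := funext fun x ↦ funext (hfib x)
  congr
  funext x y hx hy k
  exact eq_of_heq (hmap hx hy k)

/-- The data that extend a section `s` of `P` to one more object `x`: the arrows `inn g` and
`out g` will be the values at the arrows `g` between `x` and the objects where `s` is defined. -/
structure Bicone (s : P.PartialSection W) (x : C) where
  pt : P.Fib x
  inn {y : C} (hy : W y) (g : y ⟶ x) : P.total (s.fib y hy) ⟶ P.total pt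
  out {y : C} (hy : W y) (g : x ⟶ y) : P.total pt ⟶ P.total (s.fib y hy)
  isOver_inn {y : C} (hy : W y) (g : y ⟶ x) : P.IsOver g (s.fib y hy) pt (inn hy g)
  isOver_out {y : C} (hy : W y) (g : x ⟶ y) : P.IsOver g pt (s.fib y hy) (out hy g)
  map_inn {y z : C} (hy : W y) (hz : W z) (k : y ⟶ z) (g : z ⟶ x) :
    s.maps.map hy hz k ≫ inn hz g = inn hy (k ≫ g)
  out_map {y z : C} (hy : W y) (hz : W z) (g : x ⟶ y) (k : y ⟶ z) :
    out hy g ≫ s.maps.map hy hz k = out hz (g ≫ k)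
  inn_out {y z : C} (hy : W y) (hz : W z) (g : y ⟶ x) (h : x ⟶ z) :
    inn hy g ≫ out hz h = s.maps.map hy hz (g ≫ h)

/-- The restriction of a bicone on a section to a bicone on a restriction of the section. -/
def Bicone.restrict {s : P.PartialSection W'} {x : C} (b : s.Bicone x) (h : W ≤ W') :
    (s.restrict h).Bicone x where
  pt := b.pt
  inn hy g := b.inn (h _ hy) g
  out hy g := b.out (h _ hy) g
  isOver_inn _ _ := b.isOver_inn _ _
  isOver_out _ _ := b.isOver_out _ _
  map_inn _ _ _ _ := b.map_inn _ _ _ _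
  out_map _ _ _ _ := b.out_map _ _ _ _
  inn_out _ _ _ _ := b.inn_out _ _ _ _

/-- The bicone of the values of a section at the arrows from and to an object `x`. -/
def bicone (s : P.PartialSection W') (h : W ≤ W') (x : C) (hx : W' x) :
    (s.restrict h).Bicone x where
  pt := s.fib x hx
  inn hy g := s.maps.map (h _ hy) hx g
  out hy g := s.maps.map hx (h _ hy) g
  isOver_inn _ _ := s.maps.isOver _ _ _
  isOver_out _ _ := s.maps.isOver _ _ _
  map_inn _ _ _ _ := (s.maps.map_comp _ _ _ _ _).symm
  out_map _ _ _ _ := (s.maps.map_comp _ _ _ _ _).symm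
  inn_out _ _ _ _ := (s.maps.map_comp _ _ _ _ _).symm

lemma Bicone.heq_of_heq {s s' : P.PartialSection W} (hs : s = s') {x : C} {b : s.Bicone x}
    {b' : s'.Bicone x} (hpt : b.pt = b'.pt)
    (hinn : ∀ {y : C} hy (g : y ⟶ x), HEq (b.inn hy g) (b'.inn hy g))
    (hout : ∀ {y : C} hy (g : x ⟶ y), HEq (b.out hy g) (b'.out hy g)) : HEq b b' := by
  subst hs
  obtain ⟨⟩ := b
  obtain ⟨⟩ := b'
  obtain rfl := hpt
  congr
  · funext y hy g
    exact eq_of_heq (hinn hy g)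
  · funext y hy g
    exact eq_of_heq (hout hy g)

section Glue

variable {J : Type*} [LinearOrder J] {V : J → ObjectProperty C} (hV : Monotone V)
  (hW : ∀ j, V j ≤ W)

include hV in
lemma exists_fib_of_compatible (hWV : ∀ x, W x → ∃ j, V j x)
    (s : ∀ j, P.PartialSection (V j)) (hs : ∀ i j (h : i ≤ j), (s j).restrict (hV h) = s i) :
    ∃ fib : ∀ x, W x → P.Fib x, ∀ j, ∃ m : P.SectionMaps fun x hx ↦ fib x (hW j x hx),
      s j = ⟨_, m⟩ := by
  choose idx hidx using hWV
  refine ⟨fun x hx ↦ (s (idx x hx)).fib x (hidx x hx), fun j ↦ ?_⟩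
  have hfib : (s j).fib = fun x hx ↦ (s (idx x (hW j x hx))).fib x (hidx x _) := by
    funext x hx
    obtain h | h := le_total j (idx x (hW j x hx))
    · rw [← hs _ _ h]; rfl
    · rw [← hs _ _ h]; rfl
  rw [← hfib]
  exact ⟨(s j).maps, rfl⟩

lemma exists_glue (hWV : ∀ x, W x → ∃ j, V j x) (s : ∀ j, P.PartialSection (V j))
    (hs : ∀ i j (h : i ≤ j), (s j).restrict (hV h) = s i) :
    ∃ t : P.PartialSection W, ∀ j, t.restrict (hW j) = s j := by
  obtain ⟨fib, hfib⟩ := exists_fib_of_compatible hV hW hWV s hs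
  choose m hm using hfib
  have map_eq_of_le {i j} (h : i ≤ j) {x y : C} (hx : V i x) (hy : V i y) (k : x ⟶ y) :
      (m j).map (hV h _ hx) (hV h _ hy) k = (m i).map hx hy k := by
    have h' := hs i j h
    rw [hm, hm] at h'
    injection h' with _ h'
    exact congrArg (fun m : P.SectionMaps _ ↦ m.map hx hy k) h'
  have map_eq (i j) {x y : C} (hxi : V i x) (hyi : V i y) (hxj : V j x) (hyj : V j y)
      (k : x ⟶ y) : (m i).map hxi hyi k = (m j).map hxj hyj k := by
    obtain h | h := le_total i j
    · exact (map_eq_of_le h _ _ _).symm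
    · exact map_eq_of_le h _ _ _
  have hWV₂ {x y : C} (hx : W x) (hy : W y) : ∃ j, V j x ∧ V j y := by
    obtain ⟨i, hi⟩ := hWV x hx
    obtain ⟨j, hj⟩ := hWV y hy
    exact ⟨max i j, hV (le_max_left i j) _ hi, hV (le_max_right i j) _ hj⟩
  choose idx hl hr using @hWV₂
  refine ⟨⟨fib, ⟨fun hx hy k ↦ (m (idx hx hy)).map (hl hx hy) (hr hx hy) k,
    fun _ _ k ↦ (m _).isOver _ _ k, fun hx ↦ (m _).map_id (hl hx hx), ?_⟩⟩, fun j ↦ ?_⟩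
  · intro x y z hx hy hz k l
    let j := max (idx hx hy) (idx hy hz)
    have hjx : V j x := hV (le_max_left _ _) _ (hl hx hy)
    have hjy : V j y := hV (le_max_left _ _) _ (hr hx hy)
    have hjz : V j z := hV (le_max_right _ _) _ (hr hy hz)
    rw [map_eq _ j _ _ hjx hjy k, map_eq _ j _ _ hjy hjz l, map_eq _ j _ _ hjx hjz (k ≫ l),
      (m j).map_comp]
  · rw [hm]
    exact ext_of_heq (fun _ _ ↦ rfl) fun hx hy k ↦ heq_of_eq (map_eq _ _ _ _ hx hy k)

end Glue

section Extend

variable {s : P.PartialSection W} (b : ∀ x, W' x → s.Bicone x)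

/-- The arrows between the vertices of the bicones `b` which must be the values at `k` of any
section that extends `s` and has `b` as its bicones. -/
inductive ExtendedMap : ∀ {x y : C} (hx : W' x) (hy : W' y) (_ : x ⟶ y),
    (P.total (b x hx).pt ⟶ P.total (b y hy).pt) → Prop
  | id {x : C} (hx : W' x) : ExtendedMap hx hx (𝟙 x) (𝟙 _)
  | comp {x y z : C} (hx : W' x) (hy : W' y) (hz : W z) (k : x ⟶ z) (l : z ⟶ y) :
    ExtendedMap hx hy (k ≫ l) ((b x hx).out hz k ≫ (b y hy).inn hz l)

variable {b}

lemma ExtendedMap.isOver {x y : C} {hx : W' x} {hy : W' y} {k : x ⟶ y} {φ}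
    (h : ExtendedMap b hx hy k φ) : P.IsOver k (b x hx).pt (b y hy).pt φ := by
  cases h with
  | id => exact P.isOver_id _
  | comp _ _ hz k l => exact P.isOver_comp ((b _ _).isOver_out hz k) ((b _ _).isOver_inn hz l)

lemma ExtendedMap.trans {x y z : C} {hx : W' x} {hy : W' y} {hz : W' z} {k : x ⟶ y} {l : y ⟶ z}
    {φ ψ} (hφ : ExtendedMap b hx hy k φ) (hψ : ExtendedMap b hy hz l ψ) :
    ExtendedMap b hx hz (k ≫ l) (φ ≫ ψ) := by
  cases hφ with
  | id => simpa only [Category.id_comp] using hψ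
  | comp _ _ hw k₁ k₂ =>
    cases hψ with
    | id => simpa only [Category.comp_id] using ExtendedMap.comp _ _ hw k₁ k₂
    | comp _ _ hw' l₁ l₂ =>
      have e : ((b x hx).out hw k₁ ≫ (b y hy).inn hw k₂) ≫
          (b y hy).out hw' l₁ ≫ (b z hz).inn hw' l₂ =
          (b x hx).out hw k₁ ≫ (b z hz).inn hw (k₂ ≫ l₁ ≫ l₂) := by
        rw [Category.assoc, ← Category.assoc ((b y hy).inn hw k₂), (b y hy).inn_out,
          (b z hz).map_inn, Category.assoc]
      rw [e, Category.assoc]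
      exact .comp _ _ hw k₁ (k₂ ≫ l₁ ≫ l₂)

lemma ExtendedMap.unique
    (hcoh : ∀ {x y z z' : C} (hx : W' x) (hy : W' y) (hz : W z) (hz' : W z') (k : x ⟶ z)
      (l : z ⟶ y) (k' : x ⟶ z') (l' : z' ⟶ y), k ≫ l = k' ≫ l' →
      (b x hx).out hz k ≫ (b y hy).inn hz l = (b x hx).out hz' k' ≫ (b y hy).inn hz' l')
    (hid : ∀ {x z : C} (hx : W' x) (hz : W z) (k : x ⟶ z) (l : z ⟶ x), k ≫ l = 𝟙 x →
      (b x hx).out hz k ≫ (b x hx).inn hz l = 𝟙 _)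
    {x y : C} {hx : W' x} {hy : W' y} {k k' : x ⟶ y} {φ φ'}
    (hφ : ExtendedMap b hx hy k φ) (hφ' : ExtendedMap b hx hy k' φ') (h : k = k') : φ = φ' := by
  cases hφ with
  | id => cases hφ' with
    | id => rfl
    | comp _ _ hz' k' l' => exact (hid _ hz' k' l' h.symm).symm
  | comp _ _ hz k l => cases hφ' with
    | id => exact hid _ hz k l h
    | comp _ _ hz' k' l' => exact hcoh _ _ hz hz' k l k' l' h

lemma exists_extension (hWW' : W ≤ W')
    (hfac : ∀ {x y : C}, W' x → W' y → ∀ k : x ⟶ y, (∃ e : x = y, k = eqToHom e) ∨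
      ∃ (z : C) (k₁ : x ⟶ z) (k₂ : z ⟶ y), W z ∧ k₁ ≫ k₂ = k)
    (hcoh : ∀ {x y z z' : C} (hx : W' x) (hy : W' y) (hz : W z) (hz' : W z') (k : x ⟶ z)
      (l : z ⟶ y) (k' : x ⟶ z') (l' : z' ⟶ y), k ≫ l = k' ≫ l' →
      (b x hx).out hz k ≫ (b y hy).inn hz l = (b x hx).out hz' k' ≫ (b y hy).inn hz' l')
    (hid : ∀ {x z : C} (hx : W' x) (hz : W z) (k : x ⟶ z) (l : z ⟶ x), k ≫ l = 𝟙 x →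
      (b x hx).out hz k ≫ (b x hx).inn hz l = 𝟙 _)
    (hself : ∀ x (hx : W x), b x (hWW' x hx) = s.bicone le_rfl x hx) :
    ∃ t : P.PartialSection W', ∃ _ : t.restrict hWW' = s,
      ∀ x hx, HEq (t.bicone hWW' x hx) (b x hx) := by
  have exists_map {x y : C} (hx : W' x) (hy : W' y) (k : x ⟶ y) :
      ∃ φ, ExtendedMap b hx hy k φ := by
    obtain ⟨rfl, rfl⟩ | ⟨z, k₁, k₂, hz, rfl⟩ := hfac hx hy k
    · exact ⟨_, .id hx⟩
    · exact ⟨_, .comp hx hy hz k₁ k₂⟩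
  choose map hmap using @exists_map
  have map_eq {x y : C} {hx : W' x} {hy : W' y} {k : x ⟶ y} {φ} (h : ExtendedMap b hx hy k φ) :
      map hx hy k = φ := (hmap hx hy k).unique hcoh hid h rfl
  let t : P.PartialSection W' := ⟨fun x hx ↦ (b x hx).pt,
    ⟨map, fun hx hy k ↦ (hmap hx hy k).isOver, fun hx ↦ map_eq (.id hx),
      fun _ _ _ k l ↦ map_eq ((hmap _ _ k).trans (hmap _ _ l))⟩⟩
  have pt_eq (x hx) : (b x (hWW' x hx)).pt = s.fib x hx := by rw [hself]; rfl
  have map_inn {x y : C} (hx : W x) (hy : W' y) (k : x ⟶ y) :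
      HEq (map (hWW' x hx) hy k) ((b y hy).inn hx k) := by
    have h := ExtendedMap.comp (b := b) (hWW' x hx) hy hx (𝟙 x) k
    rw [Category.id_comp] at h
    rw [map_eq h, hself x hx]
    refine heq_of_eq ((congrArg (· ≫ _) (s.maps.map_id hx)).trans (Category.id_comp _))
  have map_out {x y : C} (hx : W' x) (hy : W y) (k : x ⟶ y) :
      HEq (map hx (hWW' y hy) k) ((b x hx).out hy k) := by
    have h := ExtendedMap.comp (b := b) hx (hWW' y hy) hy k (𝟙 y)
    rw [Category.comp_id] at h
    rw [map_eq h, hself y hy]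
    refine heq_of_eq ((congrArg (_ ≫ ·) (s.maps.map_id hy)).trans (Category.comp_id _))
  have ht : t.restrict hWW' = s := ext_of_heq pt_eq fun {x y} hx hy k ↦
    (map_inn hx (hWW' y hy) k).trans (by rw [hself y hy]; rfl)
  exact ⟨t, ht, fun x hx ↦ Bicone.heq_of_heq ht rfl (fun hy g ↦ map_inn hy hx g)
    fun hy g ↦ map_out hx hy g⟩

end Extend

end PartialSection

section Transfinite

variable {C : Type u} [Category.{u} C] {deg : C → Ordinal.{t}} {E : Type*} [Category* E]
  {P : DisplayedCategory C E}

namespace PartialSection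

/-- The bicones of the section `s` at all objects, over the objects of lower degree, satisfy `Q`. -/
def BiconesSatisfy {W : ObjectProperty C} (s : P.PartialSection W)
    (hW : ∀ x, W x → degreeLT deg (deg x) ≤ W)
    (Q : ∀ ⦃x : C⦄ (s : P.PartialSection (degreeLT deg (deg x))), s.Bicone x → Prop) :
    Prop :=
  ∀ x hx, Q (s.restrict (hW x hx)) (s.bicone (hW x hx) x hx)

variable (hC : IsBistratifiedDiscrete deg)
  {Q : ∀ ⦃x : C⦄ (s : P.PartialSection (degreeLT deg (deg x))), s.Bicone x → Prop}
  (hQ : ∀ x (s : P.PartialSection (degreeLT deg (deg x))), ∃ b : s.Bicone x, Q s b)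

include hC in
lemma exists_succ {δ : Ordinal.{t}} (s : P.PartialSection (degreeLT deg δ))
    (b : ∀ x, degreeLT deg (δ + 1) x → s.Bicone x)
    (hself : ∀ x (hx : degreeLT deg δ x),
      b x (degreeLT_mono le_self_add x hx) = s.bicone le_rfl x hx) :
    ∃ t : P.PartialSection (degreeLT deg (δ + 1)), ∃ _ : t.restrict (degreeLT_mono le_self_add) = s,
      ∀ x hx, HEq (t.bicone (degreeLT_mono le_self_add) x hx) (b x hx) := by
  refine exists_extension _ (fun hx hy ↦ hC.eq_or_exists_factorization
    (Order.lt_add_one_iff.1 hx) (Order.lt_add_one_iff.1 hy))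
    (fun {x y _ _} hx hy hz hz' k l k' l' e ↦ ?_) (fun {x z} hx hz k l e ↦ ?_) hself
  · refine (hC.lowFactorizationsConnected (Order.lt_add_one_iff.1 hx)
      (Order.lt_add_one_iff.1 hy)).eq_of_comp_eq
      (fun z hz k l ↦ (b x hx).out hz k ≫ (b y hy).inn hz l) (fun z z' hz hz' k m l ↦ ?_)
      hz hz' k l k' l' e
    rw [← (b y hy).map_inn hz hz', ← (b x hx).out_map hz hz', Category.assoc]
  · have hxδ : deg x < δ := lt_of_not_ge fun hδ ↦ hC.comp_ne_id (lt_of_lt_of_le hz hδ) k l e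
    rw [hself x hxδ]
    exact (s.maps.map_comp hxδ hz hxδ k l).symm.trans (by rw [e]; exact s.maps.map_id hxδ)

include hC hQ in
lemma exists_succ_biconesSatisfy {δ : Ordinal.{t}} (s : P.PartialSection (degreeLT deg δ))
    (hs : s.BiconesSatisfy degreeLT_le Q) :
    ∃ t : P.PartialSection (degreeLT deg (δ + 1)),
      t.BiconesSatisfy degreeLT_le Q ∧ t.restrict (degreeLT_mono le_self_add) = s := by
  have exists_bicone (x : C) (hx : degreeLT deg (δ + 1) x) : ∃ b : s.Bicone x,
      (∀ hx : degreeLT deg δ x, b = s.bicone le_rfl x hx) ∧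
      ∀ h : deg x = δ, Q (s.restrict (degreeLT_mono h.le)) (b.restrict (degreeLT_mono h.le)) := by
    obtain hx | rfl := (Order.lt_add_one_iff.1 hx).lt_or_eq
    · exact ⟨s.bicone le_rfl x hx, fun _ ↦ rfl, fun h ↦ absurd h hx.ne⟩
    · obtain ⟨b, hb⟩ := hQ x s
      exact ⟨b, fun h ↦ absurd h (lt_irrefl _), fun _ ↦ hb⟩
  choose b hself hb using exists_bicone
  obtain ⟨t, rfl, ht⟩ := exists_succ hC s b fun x hx ↦ hself x _ hx
  refine ⟨t, fun x hx ↦ ?_, rfl⟩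
  obtain hxδ | hxδ := (Order.lt_add_one_iff.1 hx).lt_or_eq
  · exact hs x hxδ
  · have h := hb x hx hxδ
    rwa [← eq_of_heq (ht x hx)] at h

lemma exists_glue_biconesSatisfy {J : Type*} [LinearOrder J] {d : J → Ordinal.{t}}
    (hd : Monotone d) {W : ObjectProperty C} (hW : ∀ x, W x → degreeLT deg (deg x) ≤ W)
    (hdW : ∀ j, degreeLT deg (d j) ≤ W) (hWd : ∀ x, W x → ∃ j, degreeLT deg (d j) x)
    (s : ∀ j, P.PartialSection (degreeLT deg (d j)))
    (hs : ∀ i j (h : i ≤ j), (s j).restrict (degreeLT_mono (hd h)) = s i)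
    (hsQ : ∀ j, (s j).BiconesSatisfy degreeLT_le Q) :
    ∃ t : P.PartialSection W, t.BiconesSatisfy hW Q ∧ ∀ j, t.restrict (hdW j) = s j := by
  obtain ⟨t, ht⟩ := exists_glue (degreeLT_mono.comp hd) hdW hWd s hs
  refine ⟨t, fun x hx ↦ ?_, ht⟩
  obtain ⟨j, hj⟩ := hWd x hx
  have h : (t.restrict (hdW j)).BiconesSatisfy degreeLT_le Q := ht j ▸ hsQ j
  exact h x hj

end PartialSection

/-- The sections over the objects of degree `< δ` whose bicones satisfy `Q`, for varying `δ`. -/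
def sectionsOfBicones
    (Q : ∀ ⦃x : C⦄ (s : P.PartialSection (degreeLT deg (deg x))), s.Bicone x → Prop) :
    Ordinal.{t}ᵒᵖ ⥤ Type _ where
  obj δ := {s : P.PartialSection (degreeLT deg δ.unop) // s.BiconesSatisfy degreeLT_le Q}
  map h := ↾ fun s ↦ ⟨s.1.restrict (degreeLT_mono h.unop.le), fun x hx ↦
    s.2 x (degreeLT_mono h.unop.le x hx)⟩

variable (hC : IsBistratifiedDiscrete deg)
  {Q : ∀ ⦃x : C⦄ (s : P.PartialSection (degreeLT deg (deg x))), s.Bicone x → Prop}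
  (hQ : ∀ x (s : P.PartialSection (degreeLT deg (deg x))), ∃ b : s.Bicone x, Q s b)

include hC hQ

lemma sectionsOfBicones_surjective :
    Function.Surjective fun s : (sectionsOfBicones Q).sections ↦ s.1 (op ⊥) := by
  refine Functor.WellOrderInductionData.surjective <|
    .ofExists (fun δ _ s ↦ ?_) fun δ hδ s ↦ ?_
  · obtain ⟨t, ht, hts⟩ := PartialSection.exists_succ_biconesSatisfy hC hQ s.1 s.2
    exact ⟨⟨t, ht⟩, Subtype.ext hts⟩
  · obtain ⟨t, ht, hts⟩ := PartialSection.exists_glue_biconesSatisfy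
      (d := fun γ : Set.Iio δ ↦ γ.1) (fun _ _ h ↦ h) degreeLT_le (fun γ ↦ degreeLT_mono γ.2.le)
      (fun x hx ↦ ⟨⟨deg x + 1, hδ.succ_lt hx⟩, Order.lt_add_one_iff.2 le_rfl⟩)
      (fun γ ↦ (s.1 (op γ)).1) (fun _ _ h ↦ congrArg Subtype.val (s.2 (homOfLE h).op))
      fun γ ↦ (s.1 (op γ)).2
    exact ⟨⟨t, ht⟩, fun γ hγ ↦ Subtype.ext (hts ⟨γ, hγ⟩)⟩

theorem exists_section :
    ∃ s : P.PartialSection (⊤ : ObjectProperty C), s.BiconesSatisfy (fun _ _ ↦ le_top) Q := by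
  have not_lt_bot {x : C} (hx : degreeLT deg ⊥ x) : False := not_lt_bot hx
  obtain ⟨s, -⟩ := sectionsOfBicones_surjective hC hQ
    ⟨⟨fun _ hx ↦ (not_lt_bot hx).elim, ⟨fun hx ↦ (not_lt_bot hx).elim,
      fun hx ↦ (not_lt_bot hx).elim, fun hx ↦ (not_lt_bot hx).elim,
      fun hx ↦ (not_lt_bot hx).elim⟩⟩, fun _ hx ↦ (not_lt_bot hx).elim⟩
  obtain ⟨t, ht, -⟩ := PartialSection.exists_glue_biconesSatisfy monotone_id (fun _ _ ↦ le_top)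
    (fun _ ↦ le_top) (fun x _ ↦ ⟨deg x + 1, Order.lt_add_one_iff.2 le_rfl⟩)
    (fun δ ↦ (s.1 (op δ)).1) (fun _ _ h ↦ congrArg Subtype.val (s.2 (homOfLE h).op))
    fun δ ↦ (s.1 (op δ)).2
  exact ⟨t, ht⟩

end Transfinite

end DisplayedCategory

section WeightedColimit

variable {D : Type u} [Category.{u} D] {M : Type w} [Category.{v} M] [HasColimitsOfSize.{u, u} M]
  (U : Dᵒᵖ ⥤ Type u)

lemma weightedColim.ι_w (X : D ⥤ M) {c c' : D} (k : c ⟶ c') (p : U.obj (op c')) :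
    X.map k ≫ weightedColim.ι U X p = weightedColim.ι U X (U.map k.op p) :=
  colimit.w ((CategoryOfElements.π U).leftOp ⋙ X)
    (Quiver.Hom.op (CategoryOfElements.homMk (U.elementsMk (op c') p)
      (U.elementsMk (op c) (U.map k.op p)) k.op rfl))

lemma weightedColim.map_id (X : D ⥤ M) : weightedColim.map U (𝟙 X) = 𝟙 (weightedColim U X) :=
  weightedColim.hom_ext fun c p ↦ by
    rw [weightedColim.ι_map, NatTrans.id_app, Category.id_comp, Category.comp_id]

lemma weightedColim.map_comp {X Y Z : D ⥤ M} (f : X ⟶ Y) (g : Y ⟶ Z) :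
    weightedColim.map U (f ≫ g) = weightedColim.map U f ≫ weightedColim.map U g :=
  weightedColim.hom_ext fun c p ↦ by
    rw [← Category.assoc, weightedColim.ι_map, weightedColim.ι_map, NatTrans.comp_app,
      Category.assoc, Category.assoc, weightedColim.ι_map]

end WeightedColimit

section WeightedLimit

variable {D : Type u} [Category.{u} D] {M : Type w} [Category.{v} M] [HasLimitsOfSize.{u, u} M]
  (W : D ⥤ Type u) (X : D ⥤ M) {Z : M}

/-- Maps into the weighted limit; this is dual to `weightedColim.desc`. -/
noncomputable def weightedLimLift (φ : ∀ ⦃c : D⦄, W.obj c → (Z ⟶ X.obj c))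
    (hφ : ∀ ⦃c c' : D⦄ (k : c ⟶ c') (p : W.obj c), φ p ≫ X.map k = φ (W.map k p)) :
    Z ⟶ W.weightedLimObjObj X :=
  (W.isLimitWeightedLimCone X).lift φ fun _ _ p k ↦ hφ k p

lemma weightedLimLift_π (φ : ∀ ⦃c : D⦄, W.obj c → (Z ⟶ X.obj c)) (hφ) {c : D} (p : W.obj c) :
    weightedLimLift W X φ hφ ≫ W.weightedLimObjObjπ X p = φ p :=
  Functor.isLimitWeightedLimCone_fac _ _ _ _ _

end WeightedLimit

section LatchingToMatching

variable {C : Type u} [Category.{u} C] (deg : C → Ordinal.{t}) {M : Type w} [Category.{v} M]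
  [HasLimitsOfSize.{u, u} M] [HasColimitsOfSize.{u, u} M] (x : C)

/-- The map from the latching object to the matching object of a diagram on `C_δ` at an object `x`,
which an extension of the diagram to `x` has to factor. Its components are the `E (g ≫ h)` for
`g : y ⟶ x` and `h : x ⟶ z`. -/
noncomputable def latchingToMatching {δ : Ordinal.{t}} (E : Below deg δ ⥤ M) :
    weightedColim (homTo deg x δ) E ⟶ (homFrom deg x δ).weightedLimObjObj E :=
  weightedColim.desc _ _
    (fun y (g : y.obj ⟶ x) ↦ weightedLimLift (homFrom deg x δ) E
      (fun z (h : x ⟶ z.obj) ↦ E.map (ObjectProperty.homMk (g ≫ h)))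
      fun z z' k (h : x ⟶ z.obj) ↦ by
        rw [← E.map_comp]
        exact congrArg E.map (ObjectProperty.hom_ext _ (Category.assoc _ _ _)))
    fun y y' k (g : y'.obj ⟶ x) ↦ Functor.weightedLimObjObj.hom_ext fun {z} h ↦ by
      rw [Category.assoc, weightedLimLift_π, weightedLimLift_π, ← E.map_comp]
      exact congrArg E.map (ObjectProperty.hom_ext _ (Category.assoc _ _ _))

variable {deg x}

lemma ι_latchingToMatching_π {δ : Ordinal.{t}} (E : Below deg δ ⥤ M) {y z : Below deg δ}
    (g : y.obj ⟶ x) (h : x ⟶ z.obj) :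
    weightedColim.ι (homTo deg x δ) E (c := y) g ≫ latchingToMatching deg x E ≫
      (homFrom deg x δ).weightedLimObjObjπ E (j := z) h =
        E.map (ObjectProperty.homMk (g ≫ h)) := by
  rw [latchingToMatching, ← Category.assoc, weightedColim.ι_desc, weightedLimLift_π]

lemma eq_latchingToMatching {δ : Ordinal.{t}} {E : Below deg δ ⥤ M}
    {φ : weightedColim (homTo deg x δ) E ⟶ (homFrom deg x δ).weightedLimObjObj E}
    (hφ : ∀ {y z : Below deg δ} (g : y.obj ⟶ x) (h : x ⟶ z.obj),
      weightedColim.ι (homTo deg x δ) E (c := y) g ≫ φ ≫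
        (homFrom deg x δ).weightedLimObjObjπ E (j := z) h =
          E.map (ObjectProperty.homMk (g ≫ h))) :
    φ = latchingToMatching deg x E :=
  weightedColim.hom_ext fun y g ↦ Functor.weightedLimObjObj.hom_ext fun {z} h ↦ by
    rw [Category.assoc, Category.assoc, hφ, ι_latchingToMatching_π]

lemma latchingToMatching_naturality {δ : Ordinal.{t}} {E F : Below deg δ ⥤ M} (φ : E ⟶ F) :
    weightedColim.map _ φ ≫ latchingToMatching deg x F =
      latchingToMatching deg x E ≫ (homFrom deg x δ).weightedLimObjMap φ :=
  weightedColim.hom_ext fun y (g : y.obj ⟶ x) ↦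
    Functor.weightedLimObjObj.hom_ext fun {z} (h : x ⟶ z.obj) ↦ by
      rw [Category.assoc, Category.assoc, Category.assoc, Category.assoc,
        Functor.weightedLimObjMap_π, ← Category.assoc, weightedColim.ι_map, Category.assoc,
        ι_latchingToMatching_π, ← φ.naturality, ← ι_latchingToMatching_π, Category.assoc,
        Category.assoc]

lemma fromLatching_toMatching (A : C ⥤ M) :
    fromLatching deg x A ≫ toMatching deg x A =
      latchingToMatching deg x (Below.ι deg (deg x) ⋙ A) :=
  eq_latchingToMatching fun g h ↦ by
    rw [Category.assoc, toMatching_π, ← Category.assoc, ι_fromLatching, ← A.map_comp]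
    rfl

end LatchingToMatching

namespace DisplayedCategory

section Bicone

variable {C : Type u} [Category.{u} C] {deg : C → Ordinal.{t}} {M : Type w} [Category.{v} M]
  {P : DisplayedCategory C M} {δ : Ordinal.{t}} {s : P.PartialSection (degreeLT deg δ)} {x : C}

namespace PartialSection.Bicone

section Desc

variable [HasColimitsOfSize.{u, u} M]

/-- The map from the latching object of a section to the vertex of a bicone on it, with components
`inn`. -/
noncomputable def desc (b : s.Bicone x) :
    weightedColim (homTo deg x δ) s.functor ⟶ P.total b.pt :=
  weightedColim.desc _ _ (fun y g ↦ b.inn y.property g)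
    fun _ _ _ _ ↦ (b.map_inn _ _ _ _).symm

lemma ι_desc (b : s.Bicone x) {y : Below deg δ} (g : y.obj ⟶ x) :
    weightedColim.ι (homTo deg x δ) s.functor (c := y) g ≫ b.desc = b.inn y.property g :=
  weightedColim.ι_desc _ _ _ _ _

end Desc

section Lift

variable [HasLimitsOfSize.{u, u} M]

/-- The map from the vertex of a bicone on a section to the matching object of the section, with
components `out`. -/
noncomputable def lift (b : s.Bicone x) :
    P.total b.pt ⟶ (homFrom deg x δ).weightedLimObjObj s.functor :=
  weightedLimLift _ _ (fun y g ↦ b.out y.property g) fun _ _ _ _ ↦ b.out_map _ _ _ _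

lemma lift_π (b : s.Bicone x) {y : Below deg δ} (g : x ⟶ y.obj) :
    b.lift ≫ (homFrom deg x δ).weightedLimObjObjπ s.functor (j := y) g = b.out y.property g :=
  weightedLimLift_π _ _ _ _ _

end Lift

section OfFactorization

variable [HasLimitsOfSize.{u, u} M] [HasColimitsOfSize.{u, u} M] (X : P.Fib x)
  (l : weightedColim (homTo deg x δ) s.functor ⟶ P.total X)
  (m : P.total X ⟶ (homFrom deg x δ).weightedLimObjObj s.functor)
  (fac : l ≫ m = latchingToMatching deg x s.functor)
  (isOver_l : ∀ {y : Below deg δ} (g : y.obj ⟶ x),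
    P.IsOver g (s.fib y.obj y.property) X
      (weightedColim.ι (homTo deg x δ) s.functor (c := y) g ≫ l))
  (isOver_m : ∀ {y : Below deg δ} (g : x ⟶ y.obj),
    P.IsOver g X (s.fib y.obj y.property)
      (m ≫ (homFrom deg x δ).weightedLimObjObjπ s.functor (j := y) g))

/-- The bicone with vertex `X` given by a factorization through `P.total X` of the map from the
latching object to the matching object of the section. -/
noncomputable def ofFactorization : s.Bicone x where
  pt := X
  inn {y} hy g := weightedColim.ι (homTo deg x δ) s.functor (c := ⟨y, hy⟩) g ≫ l
  out {y} hy g := m ≫ (homFrom deg x δ).weightedLimObjObjπ s.functor (j := ⟨y, hy⟩) g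
  isOver_inn {y} hy g := isOver_l (y := ⟨y, hy⟩) g
  isOver_out {y} hy g := isOver_m (y := ⟨y, hy⟩) g
  map_inn {y z} hy hz k g :=
    (reassoc_of% weightedColim.ι_w (homTo deg x δ) s.functor (c := ⟨y, hy⟩) (c' := ⟨z, hz⟩)
      (ObjectProperty.homMk k) g) l
  out_map {y z} hy hz g k := (Category.assoc _ _ _).trans
    (congrArg (m ≫ ·) ((homFrom deg x δ).weightedLimObjObj_w s.functor (j₁ := ⟨y, hy⟩)
      (j₂ := ⟨z, hz⟩) g (ObjectProperty.homMk k)))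
  inn_out {y z} hy hz g h := by
    have e := ι_latchingToMatching_π s.functor (y := ⟨y, hy⟩) (z := ⟨z, hz⟩) g h
    rw [← fac, Category.assoc] at e
    exact (Category.assoc _ _ _).trans e

end OfFactorization

end PartialSection.Bicone

end Bicone

end DisplayedCategory

section Factorisations

variable {C : Type u} [Category.{u} C] {M : Type w} [Category.{v} M] {A B : C ⥤ M}

/-- The displayed category of the factorizations of the components of a natural transformation
`f : A ⟶ B`, whose sections are the factorizations of `f`. -/
abbrev factorisations (f : A ⟶ B) : DisplayedCategory C M where
  Fib x := Factorisation (f.app x)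
  total X := X.mid
  IsOver k X Y φ := X.ι ≫ φ = A.map k ≫ Y.ι ∧ φ ≫ Y.π = X.π ≫ B.map k
  isOver_id X := by simp
  isOver_comp h h' := by
    simp [reassoc_of% h.1, ← reassoc_of% h.2, h'.1, h'.2]

namespace DisplayedCategory.PartialSection

variable {f : A ⟶ B}

section Functor

variable {W : ObjectProperty C} (s : (factorisations f).PartialSection W)

/-- The first factor of the factorization of a natural transformation given by a section. -/
@[simps]
def fromSource : W.ι ⋙ A ⟶ s.functor where
  app x := (s.fib x.obj x.property).ι
  naturality _ _ k := (s.maps.isOver _ _ k.hom).1.symm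

/-- The second factor of the factorization of a natural transformation given by a section. -/
@[simps]
def toTarget : s.functor ⟶ W.ι ⋙ B where
  app x := (s.fib x.obj x.property).π
  naturality _ _ k := (s.maps.isOver _ _ k.hom).2

lemma fromSource_toTarget : s.fromSource ≫ s.toTarget = Functor.whiskerLeft W.ι f := by
  ext x
  exact (s.fib x.obj x.property).ι_π

end Functor

variable {deg : C → Ordinal.{t}} {x : C}
  {s : (factorisations f).PartialSection (degreeLT deg (deg x))}

section RelLatching

variable [HasColimitsOfSize.{u, u} M]

lemma weightedColimMap_fromSource_toTarget :
    weightedColim.map (homTo deg x (deg x)) s.fromSource ≫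
      weightedColim.map (homTo deg x (deg x)) s.toTarget = latchingMap deg x f := by
  rw [← weightedColim.map_comp, fromSource_toTarget]
  rfl

namespace Bicone

variable (b : s.Bicone x)

/-- The relative latching map at `x` of the first factor of an extension of `s` to `x`. -/
noncomputable def relLatching [HasPushouts M] :
    pushout (weightedColim.map (homTo deg x (deg x)) s.fromSource) (fromLatching deg x A) ⟶
      b.pt.mid :=
  pushout.desc b.desc b.pt.ι <| weightedColim.hom_ext fun y g ↦ by
    rw [← Category.assoc, weightedColim.ι_map, Category.assoc, ι_desc, ← Category.assoc,
      ι_fromLatching]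
    exact (b.isOver_inn _ _).1

end Bicone

lemma fromSource_ι_inl [HasPushouts M] {Z : M}
    (i : pushout (weightedColim.map (homTo deg x (deg x)) s.fromSource) (fromLatching deg x A) ⟶ Z)
    {y : Below deg (deg x)} (g : y.obj ⟶ x) :
    s.fromSource.app y ≫ weightedColim.ι (homTo deg x (deg x)) s.functor (c := y) g ≫
      pushout.inl _ _ ≫ i = A.map g ≫ pushout.inr _ _ ≫ i := by
  rw [← reassoc_of% weightedColim.ι_map, pushout.condition_assoc,
    reassoc_of% ι_fromLatching]

end RelLatching

section RelMatching

variable [HasLimitsOfSize.{u, u} M]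

lemma weightedLimObjMap_fromSource_toTarget :
    (homFrom deg x (deg x)).weightedLimObjMap s.fromSource ≫
      (homFrom deg x (deg x)).weightedLimObjMap s.toTarget = matchingMap deg x f := by
  rw [← Functor.weightedLimObjMap_comp, fromSource_toTarget]
  rfl

/-- The relative matching map at `x` of the second factor of an extension of `s` to `x`. -/
noncomputable def Bicone.relMatching [HasPullbacks M] (b : s.Bicone x) :
    b.pt.mid ⟶
      pullback ((homFrom deg x (deg x)).weightedLimObjMap s.toTarget) (toMatching deg x B) :=
  pullback.lift b.lift b.pt.π <| Functor.weightedLimObjObj.hom_ext fun {y} g ↦ by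
    rw [Category.assoc, Functor.weightedLimObjMap_π, ← Category.assoc, lift_π, Category.assoc,
      toMatching_π]
    exact (b.isOver_out _ _).2

lemma fst_π_toTarget [HasPullbacks M] {Z : M}
    (p : Z ⟶ pullback ((homFrom deg x (deg x)).weightedLimObjMap s.toTarget) (toMatching deg x B))
    {y : Below deg (deg x)} (g : x ⟶ y.obj) :
    ((p ≫ pullback.fst _ _) ≫
      (homFrom deg x (deg x)).weightedLimObjObjπ s.functor (j := y) g) ≫ s.toTarget.app y =
        (p ≫ pullback.snd _ _) ≫ B.map g := by
  rw [Category.assoc, ← Functor.weightedLimObjMap_π, Category.assoc, Category.assoc,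
    pullback.condition_assoc, toMatching_π]

end RelMatching

variable [HasLimitsOfSize.{u, u} M] [HasColimitsOfSize.{u, u} M] [HasPushouts M] [HasPullbacks M]

variable (s) in
/-- The map which a factorization of `f.app x` has to factor in order to extend `s` to `x`: from the
source of the relative latching map of the first factor at `x` to the target of the relative
matching map of the second factor. -/
noncomputable def relLatchingToRelMatching :
    pushout (weightedColim.map (homTo deg x (deg x)) s.fromSource) (fromLatching deg x A) ⟶
      pullback ((homFrom deg x (deg x)).weightedLimObjMap s.toTarget) (toMatching deg x B) :=
  pushout.desc
    (pullback.lift (latchingToMatching deg x s.functor)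
      (weightedColim.map _ s.toTarget ≫ fromLatching deg x B)
      (by rw [← latchingToMatching_naturality, Category.assoc, fromLatching_toMatching]))
    (pullback.lift
      (toMatching deg x A ≫ (homFrom deg x (deg x)).weightedLimObjMap s.fromSource) (f.app x)
      (by
        rw [Category.assoc, weightedLimObjMap_fromSource_toTarget, toMatching_naturality]))
    (by
      ext1
      · simp only [Category.assoc, pullback.lift_fst]
        rw [latchingToMatching_naturality, ← fromLatching_toMatching, Category.assoc]
      · simp only [Category.assoc, pullback.lift_snd]
        rw [← Category.assoc, weightedColimMap_fromSource_toTarget, fromLatching_naturality])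

lemma inl_relLatchingToRelMatching_fst :
    pushout.inl _ _ ≫ s.relLatchingToRelMatching ≫ pullback.fst _ _ =
      latchingToMatching deg x s.functor := by
  rw [relLatchingToRelMatching, pushout.inl_desc_assoc, pullback.lift_fst]

lemma inl_relLatchingToRelMatching_snd :
    pushout.inl _ _ ≫ s.relLatchingToRelMatching ≫ pullback.snd _ _ =
      weightedColim.map _ s.toTarget ≫ fromLatching deg x B := by
  rw [relLatchingToRelMatching, pushout.inl_desc_assoc, pullback.lift_snd]

lemma inr_relLatchingToRelMatching_fst :
    pushout.inr _ _ ≫ s.relLatchingToRelMatching ≫ pullback.fst _ _ =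
      toMatching deg x A ≫ (homFrom deg x (deg x)).weightedLimObjMap s.fromSource := by
  rw [relLatchingToRelMatching, pushout.inr_desc_assoc, pullback.lift_fst]

lemma inr_relLatchingToRelMatching_snd :
    pushout.inr _ _ ≫ s.relLatchingToRelMatching ≫ pullback.snd _ _ = f.app x := by
  rw [relLatchingToRelMatching, pushout.inr_desc_assoc, pullback.lift_snd]

section OfRelFactorization

variable {Z : M}
  {i : pushout (weightedColim.map (homTo deg x (deg x)) s.fromSource) (fromLatching deg x A) ⟶ Z}
  {p : Z ⟶ pullback ((homFrom deg x (deg x)).weightedLimObjMap s.toTarget) (toMatching deg x B)}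
  (fac : i ≫ p = s.relLatchingToRelMatching)

include fac

lemma ι_inl_comp_snd {y : Below deg (deg x)} (g : y.obj ⟶ x) :
    (weightedColim.ι (homTo deg x (deg x)) s.functor (c := y) g ≫ pushout.inl _ _ ≫ i) ≫
      p ≫ pullback.snd _ _ = s.toTarget.app y ≫ B.map g := by
  rw [Category.assoc, Category.assoc, reassoc_of% fac, inl_relLatchingToRelMatching_snd,
    reassoc_of% weightedColim.ι_map, ι_fromLatching]

lemma inr_comp_fst_π {y : Below deg (deg x)} (g : x ⟶ y.obj) :
    (pushout.inr _ _ ≫ i) ≫ (p ≫ pullback.fst _ _) ≫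
      (homFrom deg x (deg x)).weightedLimObjObjπ s.functor (j := y) g =
        A.map g ≫ s.fromSource.app y := by
  rw [Category.assoc, Category.assoc, reassoc_of% fac, reassoc_of% inr_relLatchingToRelMatching_fst,
    Functor.weightedLimObjMap_π, reassoc_of% toMatching_π]

lemma inl_comp_fst :
    (pushout.inl _ _ ≫ i) ≫ p ≫ pullback.fst _ _ = latchingToMatching deg x s.functor := by
  rw [Category.assoc, reassoc_of% fac, inl_relLatchingToRelMatching_fst]

lemma inr_comp_snd : (pushout.inr _ _ ≫ i) ≫ p ≫ pullback.snd _ _ = f.app x := by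
  rw [Category.assoc, reassoc_of% fac, inr_relLatchingToRelMatching_snd]

/-- The bicone given by a factorization of `s.relLatchingToRelMatching`. -/
noncomputable def Bicone.ofRelFactorization : s.Bicone x :=
  .ofFactorization
    { mid := Z
      ι := pushout.inr _ _ ≫ i
      π := p ≫ pullback.snd _ _
      ι_π := inr_comp_snd fac }
    (pushout.inl _ _ ≫ i) (p ≫ pullback.fst _ _) (inl_comp_fst fac)
    (fun g ↦ ⟨fromSource_ι_inl i g, ι_inl_comp_snd fac g⟩)
    fun g ↦ ⟨inr_comp_fst_π fac g, fst_π_toTarget p g⟩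

lemma relLatching_ofRelFactorization : (Bicone.ofRelFactorization fac).relLatching = i :=
  pushout.hom_ext
    ((pushout.inl_desc _ _ _).trans <| weightedColim.hom_ext fun _ _ ↦ Bicone.ι_desc _ _)
    (pushout.inr_desc _ _ _)

lemma relMatching_ofRelFactorization : (Bicone.ofRelFactorization fac).relMatching = p :=
  pullback.hom_ext
    ((pullback.lift_fst _ _ _).trans <|
      Functor.weightedLimObjObj.hom_ext fun _ ↦ Bicone.lift_π _ _)
    (pullback.lift_snd _ _ _)

end OfRelFactorization

lemma exists_relLatching_mem_relMatching_mem (L R : MorphismProperty M) [L.HasFactorization R] :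
    ∃ b : s.Bicone x, L b.relLatching ∧ R b.relMatching := by
  let F := L.factorizationData R s.relLatchingToRelMatching
  refine ⟨.ofRelFactorization F.fac, ?_, ?_⟩
  · rw [relLatching_ofRelFactorization]
    exact F.hi
  · rw [relMatching_ofRelFactorization]
    exact F.hp

end DisplayedCategory.PartialSection

end Factorisations

section FactorizationAxiom

variable {C : Type u} [Category.{u} C] {deg : C → Ordinal.{t}} {M : Type w} [Category.{v} M]
  [HasLimitsOfSize.{u, u} M] [HasColimitsOfSize.{u, u} M] [HasPushouts M] [HasPullbacks M]

theorem IsBistratifiedDiscrete.exists_factorization (hC : IsBistratifiedDiscrete deg)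
    (L R : MorphismProperty M) [L.HasFactorization R] {A B : C ⥤ M} (f : A ⟶ B) :
    ∃ (E : C ⥤ M) (i : A ⟶ E) (p : E ⟶ B), i ≫ p = f ∧
      (∀ x, L (relLatching deg x i)) ∧ ∀ x, R (relMatching deg x p) := by
  obtain ⟨s, hs⟩ := DisplayedCategory.exists_section (P := factorisations f) hC
    (Q := fun _ _ b ↦ L b.relLatching ∧ R b.relMatching)
    fun _ _ ↦ DisplayedCategory.PartialSection.exists_relLatching_mem_relMatching_mem L R
  let e : C ⥤ (⊤ : ObjectProperty C).FullSubcategory := (ObjectProperty.topEquivalence C).inverse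
  exact ⟨e ⋙ s.functor, Functor.whiskerLeft e s.fromSource, Functor.whiskerLeft e s.toTarget,
    congrArg (Functor.whiskerLeft e) s.fromSource_toTarget, fun x ↦ (hs x trivial).1,
    fun x ↦ (hs x trivial).2⟩

end FactorizationAxiom

section RelativeMaps

variable {C : Type u} [Category.{u} C] (deg : C → Ordinal.{t}) {M : Type w} [Category.{v} M]
  {A B : C ⥤ M} (x : C) (f : A ⟶ B)

section Latching

variable [HasColimitsOfSize.{u, u} M] [HasPushouts M]

lemma inl_relLatching : pushout.inl _ _ ≫ relLatching deg x f = fromLatching deg x B :=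
  pushout.inl_desc _ _ _

lemma inr_relLatching : pushout.inr _ _ ≫ relLatching deg x f = f.app x :=
  pushout.inr_desc _ _ _

end Latching

section Matching

variable [HasLimitsOfSize.{u, u} M] [HasPullbacks M]

lemma relMatching_fst : relMatching deg x f ≫ pullback.fst _ _ = toMatching deg x A :=
  pullback.lift_fst _ _ _

lemma relMatching_snd : relMatching deg x f ≫ pullback.snd _ _ = f.app x :=
  pullback.lift_snd _ _ _

end Matching

end RelativeMaps

section Lifting

variable {C : Type u} [Category.{u} C] {deg : C → Ordinal.{t}} {M : Type w} [Category.{v} M]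
  [HasLimitsOfSize.{u, u} M] [HasColimitsOfSize.{u, u} M] [HasPushouts M] [HasPullbacks M]
  {A B X Y : C ⥤ M} {f : A ⟶ B} {p : X ⟶ Y} {a : A ⟶ X} {b : B ⟶ Y}

lemma exists_extension_of_lift {x : C}
    [HasLiftingProperty (relLatching deg x f) (relMatching deg x p)] (sq : CommSq a f p b)
    (σ : Below.ι deg (deg x) ⋙ B ⟶ Below.ι deg (deg x) ⋙ X)
    (fac_left : Functor.whiskerLeft _ f ≫ σ = Functor.whiskerLeft _ a)
    (fac_right : σ ≫ Functor.whiskerLeft _ p = Functor.whiskerLeft _ b) :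
    ∃ l : B.obj x ⟶ X.obj x, f.app x ≫ l = a.app x ∧ l ≫ p.app x = b.app x ∧
      fromLatching deg x B ≫ l = weightedColim.map _ σ ≫ fromLatching deg x X ∧
      l ≫ toMatching deg x X =
        toMatching deg x B ≫ (homFrom deg x (deg x)).weightedLimObjMap σ := by
  have w_latching : latchingMap deg x f ≫ weightedColim.map _ σ ≫ fromLatching deg x X =
      fromLatching deg x A ≫ a.app x := by
    rw [latchingMap, ← Category.assoc, ← weightedColim.map_comp, fac_left]
    exact fromLatching_naturality deg x a
  have w_matching : (toMatching deg x B ≫ (homFrom deg x (deg x)).weightedLimObjMap σ) ≫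
      matchingMap deg x p = b.app x ≫ toMatching deg x Y := by
    rw [matchingMap, Category.assoc, ← Functor.weightedLimObjMap_comp, fac_right]
    exact toMatching_naturality deg x b
  have sq' : CommSq (pushout.desc _ _ w_latching) (relLatching deg x f) (relMatching deg x p)
      (pullback.lift _ _ w_matching) := by
    refine ⟨pushout.hom_ext (pullback.hom_ext ?_ ?_) (pullback.hom_ext ?_ ?_)⟩
    all_goals simp only [Category.assoc, pushout.inl_desc_assoc, pushout.inr_desc_assoc,
      pullback.lift_fst, pullback.lift_snd, relMatching_fst, relMatching_snd,
      reassoc_of% inl_relLatching deg x f, reassoc_of% inr_relLatching deg x f]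
    · rw [fromLatching_toMatching, latchingToMatching_naturality, ← fromLatching_toMatching,
        Category.assoc]
    · rw [← fromLatching_naturality, ← fromLatching_naturality, latchingMap,
        ← reassoc_of% weightedColim.map_comp, fac_right]
      rfl
    · rw [← toMatching_naturality, ← reassoc_of% toMatching_naturality deg x f, matchingMap,
        matchingMap, ← Functor.weightedLimObjMap_comp, fac_left]
    · exact congr_app sq.w x
  refine ⟨sq'.lift, ?_, ?_, ?_, ?_⟩
  · rw [← inr_relLatching deg x f, Category.assoc, sq'.fac_left, pushout.inr_desc]
  · rw [← relMatching_snd deg x p, reassoc_of% sq'.fac_right, pullback.lift_snd]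
  · rw [← inl_relLatching deg x f, Category.assoc, sq'.fac_left, pushout.inl_desc]
  · rw [← relMatching_fst deg x p, reassoc_of% sq'.fac_right, pullback.lift_fst]

theorem HasLowFactorizations.hasLiftingProperty (hdeg : HasLowFactorizations deg)
    (h : ∀ x, HasLiftingProperty (relLatching deg x f) (relMatching deg x p)) :
    HasLiftingProperty f p where
  sq_hasLift {a b} sq := by
    obtain ⟨s, hs⟩ := hdeg.exists_compatible_family
      (Fib := fun x ↦ { l : B.obj x ⟶ X.obj x // f.app x ≫ l = a.app x ∧ l ≫ p.app x = b.app x })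
      (Compat := fun x y k l l' ↦ B.map k ≫ l'.1 = l.1 ≫ X.map k) (by simp)
      (fun x y z k k' l l' l'' h h' ↦ by
        rw [B.map_comp, X.map_comp, Category.assoc, h', reassoc_of% h])
      (fun x s hs ↦ by
        let σ : Below.ι deg (deg x) ⋙ B ⟶ Below.ι deg (deg x) ⋙ X :=
          { app y := (s y.obj y.property).1
            naturality y z k := hs y.property z.property k.hom }
        obtain ⟨l, hfl, hlp, h_latching, h_matching⟩ := exists_extension_of_lift sq σ
          (by ext y; exact (s y.obj y.property).2.1) (by ext y; exact (s y.obj y.property).2.2)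
        refine ⟨⟨l, hfl, hlp⟩, fun y hy ↦ ⟨fun k ↦ ?_, fun k ↦ ?_⟩⟩
        · rw [← ι_fromLatching deg x B (y := ⟨y, hy⟩) k, Category.assoc, h_latching,
            reassoc_of% weightedColim.ι_map, ι_fromLatching]
        · rw [← toMatching_π deg x X (y := ⟨y, hy⟩) k, reassoc_of% h_matching,
            Functor.weightedLimObjMap_π, reassoc_of% toMatching_π])
    exact ⟨⟨{ l := { app x := (s x).1, naturality _ _ k := hs k }
              fac_left := by ext x; exact (s x).2.1
              fac_right := by ext x; exact (s x).2.2 }⟩⟩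

end Lifting

section RelativeMapFunctors

variable {C : Type u} [Category.{u} C] (deg : C → Ordinal.{t}) {M : Type w} [Category.{v} M]
  {A B A' B' A'' B'' : C ⥤ M} (x : C)
  {f : A ⟶ B} {f' : A' ⟶ B'} {f'' : A'' ⟶ B''} {a : A ⟶ A'} {b : B ⟶ B'} {a' : A' ⟶ A''}
  {b' : B' ⟶ B''}

section Latching

variable [HasColimitsOfSize.{u, u} M]

lemma latchingMap_id (A : C ⥤ M) : latchingMap deg x (𝟙 A) = 𝟙 _ :=
  weightedColim.map_id _ _

lemma latchingMap_comp (f : A ⟶ A') (g : A' ⟶ A'') :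
    latchingMap deg x (f ≫ g) = latchingMap deg x f ≫ latchingMap deg x g :=
  weightedColim.map_comp _ (Functor.whiskerLeft _ f) (Functor.whiskerLeft _ g)

variable [HasPushouts M]

/-- The functoriality of the source of the relative latching map. -/
noncomputable def relLatchingMap (sq : CommSq a f f' b) :
    pushout (latchingMap deg x f) (fromLatching deg x A) ⟶
      pushout (latchingMap deg x f') (fromLatching deg x A') :=
  pushout.map _ _ _ _ (latchingMap deg x b) (a.app x) (latchingMap deg x a)
    (by rw [← latchingMap_comp, ← latchingMap_comp, sq.w])
    (fromLatching_naturality deg x a).symm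

lemma inl_relLatchingMap (sq : CommSq a f f' b) :
    pushout.inl _ _ ≫ relLatchingMap deg x sq = latchingMap deg x b ≫ pushout.inl _ _ :=
  pushout.inl_desc _ _ _

lemma inr_relLatchingMap (sq : CommSq a f f' b) :
    pushout.inr _ _ ≫ relLatchingMap deg x sq = a.app x ≫ pushout.inr _ _ :=
  pushout.inr_desc _ _ _

lemma relLatchingMap_id (sq : CommSq (𝟙 A) f f (𝟙 B)) : relLatchingMap deg x sq = 𝟙 _ := by
  refine pushout.hom_ext ?_ ?_
  · rw [inl_relLatchingMap, latchingMap_id, Category.id_comp, Category.comp_id]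
  · rw [inr_relLatchingMap, NatTrans.id_app, Category.id_comp, Category.comp_id]

lemma relLatchingMap_comp (sq : CommSq a f f' b) (sq' : CommSq a' f' f'' b')
    (sq'' : CommSq (a ≫ a') f f'' (b ≫ b')) :
    relLatchingMap deg x sq'' = relLatchingMap deg x sq ≫ relLatchingMap deg x sq' := by
  refine pushout.hom_ext ?_ ?_
  · rw [inl_relLatchingMap, reassoc_of% inl_relLatchingMap, inl_relLatchingMap, latchingMap_comp,
      Category.assoc]
  · rw [inr_relLatchingMap, reassoc_of% inr_relLatchingMap, inr_relLatchingMap, NatTrans.comp_app,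
      Category.assoc]

lemma relLatching_naturality (sq : CommSq a f f' b) :
    relLatchingMap deg x sq ≫ relLatching deg x f' = relLatching deg x f ≫ b.app x := by
  refine pushout.hom_ext ?_ ?_
  · rw [reassoc_of% inl_relLatchingMap, inl_relLatching, reassoc_of% inl_relLatching,
      fromLatching_naturality]
  · rw [reassoc_of% inr_relLatchingMap, inr_relLatching, reassoc_of% inr_relLatching,
      ← NatTrans.comp_app, sq.w, NatTrans.comp_app]

/-- The relative latching map at `x` as a functor of the natural transformation. -/
noncomputable def relLatchingFunctor : Arrow (C ⥤ M) ⥤ Arrow M where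
  obj f := Arrow.mk (relLatching deg x f.hom)
  map φ := Arrow.homMk (relLatchingMap deg x ⟨φ.w⟩) (φ.right.app x) (relLatching_naturality deg x _)
  map_id f := Arrow.hom_ext _ _ (relLatchingMap_id deg x ⟨(𝟙 f : f ⟶ f).w⟩) rfl
  map_comp φ ψ := Arrow.hom_ext _ _ (relLatchingMap_comp deg x ⟨φ.w⟩ ⟨ψ.w⟩ ⟨(φ ≫ ψ).w⟩) rfl

end Latching

section Matching

variable [HasLimitsOfSize.{u, u} M]

lemma matchingMap_id (A : C ⥤ M) : matchingMap deg x (𝟙 A) = 𝟙 _ :=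
  Functor.weightedLimObjMap_id _ _

lemma matchingMap_comp (f : A ⟶ A') (g : A' ⟶ A'') :
    matchingMap deg x (f ≫ g) = matchingMap deg x f ≫ matchingMap deg x g :=
  Functor.weightedLimObjMap_comp _ (Functor.whiskerLeft _ f) (Functor.whiskerLeft _ g)

variable [HasPullbacks M]

/-- The functoriality of the target of the relative matching map. -/
noncomputable def relMatchingMap (sq : CommSq a f f' b) :
    pullback (matchingMap deg x f) (toMatching deg x B) ⟶
      pullback (matchingMap deg x f') (toMatching deg x B') :=
  pullback.map _ _ _ _ (matchingMap deg x a) (b.app x) (matchingMap deg x b)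
    (by rw [← matchingMap_comp, ← matchingMap_comp, sq.w]) (toMatching_naturality deg x b)

lemma relMatchingMap_fst (sq : CommSq a f f' b) :
    relMatchingMap deg x sq ≫ pullback.fst _ _ = pullback.fst _ _ ≫ matchingMap deg x a :=
  pullback.lift_fst _ _ _

lemma relMatchingMap_snd (sq : CommSq a f f' b) :
    relMatchingMap deg x sq ≫ pullback.snd _ _ = pullback.snd _ _ ≫ b.app x :=
  pullback.lift_snd _ _ _

lemma relMatchingMap_id (sq : CommSq (𝟙 A) f f (𝟙 B)) : relMatchingMap deg x sq = 𝟙 _ := by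
  refine pullback.hom_ext ?_ ?_
  · rw [relMatchingMap_fst, matchingMap_id, Category.id_comp, Category.comp_id]
  · rw [relMatchingMap_snd, NatTrans.id_app, Category.id_comp, Category.comp_id]

lemma relMatchingMap_comp (sq : CommSq a f f' b) (sq' : CommSq a' f' f'' b')
    (sq'' : CommSq (a ≫ a') f f'' (b ≫ b')) :
    relMatchingMap deg x sq'' = relMatchingMap deg x sq ≫ relMatchingMap deg x sq' := by
  refine pullback.hom_ext ?_ ?_
  · rw [relMatchingMap_fst, Category.assoc, relMatchingMap_fst, reassoc_of% relMatchingMap_fst,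
      matchingMap_comp]
  · rw [relMatchingMap_snd, Category.assoc, relMatchingMap_snd, reassoc_of% relMatchingMap_snd,
      NatTrans.comp_app]

lemma relMatching_naturality (sq : CommSq a f f' b) :
    a.app x ≫ relMatching deg x f' = relMatching deg x f ≫ relMatchingMap deg x sq := by
  refine pullback.hom_ext ?_ ?_
  · rw [Category.assoc, Category.assoc, relMatchingMap_fst, relMatching_fst,
      reassoc_of% relMatching_fst, toMatching_naturality]
  · rw [Category.assoc, Category.assoc, relMatchingMap_snd, relMatching_snd,
      reassoc_of% relMatching_snd, ← NatTrans.comp_app, sq.w, NatTrans.comp_app]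

/-- The relative matching map at `x` as a functor of the natural transformation. -/
noncomputable def relMatchingFunctor : Arrow (C ⥤ M) ⥤ Arrow M where
  obj f := Arrow.mk (relMatching deg x f.hom)
  map φ := Arrow.homMk (φ.left.app x) (relMatchingMap deg x ⟨φ.w⟩) (relMatching_naturality deg x _)
  map_id f := Arrow.hom_ext _ _ rfl (relMatchingMap_id deg x ⟨(𝟙 f : f ⟶ f).w⟩)
  map_comp φ ψ := Arrow.hom_ext _ _ rfl (relMatchingMap_comp deg x ⟨φ.w⟩ ⟨ψ.w⟩ ⟨(φ ≫ ψ).w⟩)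

end Matching

end RelativeMapFunctors

section ReedyFactorizationSystem

variable {C : Type u} [Category.{u} C] (deg : C → Ordinal.{t}) {M : Type w} [Category.{v} M]

section Left

variable [HasColimitsOfSize.{u, u} M] [HasPushouts M] (L : MorphismProperty M)

/-- The left class of the Reedy weak factorization system on `C ⥤ M`: the natural transformations
whose relative latching maps belong to `L`. -/
def reedyLeft : MorphismProperty (C ⥤ M) :=
  fun _ _ f ↦ ∀ x : C, L (relLatching deg x f)

instance [L.IsStableUnderRetracts] : (reedyLeft deg L).IsStableUnderRetracts where
  of_retract r h x := L.of_retract (Retract.map r (relLatchingFunctor deg x)) (h x)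

end Left

section Right

variable [HasLimitsOfSize.{u, u} M] [HasPullbacks M] (R : MorphismProperty M)

/-- The right class of the Reedy weak factorization system on `C ⥤ M`: the natural transformations
whose relative matching maps belong to `R`. -/
def reedyRight : MorphismProperty (C ⥤ M) :=
  fun _ _ f ↦ ∀ x : C, R (relMatching deg x f)

instance [R.IsStableUnderRetracts] : (reedyRight deg R).IsStableUnderRetracts where
  of_retract r h x := R.of_retract (Retract.map r (relMatchingFunctor deg x)) (h x)

end Right

variable {deg} [HasLimitsOfSize.{u, u} M] [HasColimitsOfSize.{u, u} M] [HasPullbacks M]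
  [HasPushouts M]

theorem IsBistratifiedDiscrete.isWeakFactorizationSystem (hC : IsBistratifiedDiscrete deg)
    (L R : MorphismProperty M) [L.IsWeakFactorizationSystem R] :
    (reedyLeft deg L).IsWeakFactorizationSystem (reedyRight deg R) := by
  have : (reedyLeft deg L).HasFactorization (reedyRight deg R) := by
    refine ⟨fun f ↦ ?_⟩
    obtain ⟨E, i, p, fac, hi, hp⟩ := hC.exists_factorization L R f
    exact ⟨⟨E, i, p, fac, hi, hp⟩⟩
  have : L.IsStableUnderRetracts := by rw [← MorphismProperty.llp_eq_of_wfs L R]; infer_instance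
  have : R.IsStableUnderRetracts := by rw [← MorphismProperty.rlp_eq_of_wfs L R]; infer_instance
  exact .mk' _ _ fun i p hi hp ↦ hC.hasLowFactorizations.hasLiftingProperty fun x ↦
    MorphismProperty.hasLiftingProperty_of_wfs _ _ (hi x) (hp x)

end ReedyFactorizationSystem

section LatchingMap

variable {C : Type u} [Category.{u} C] {deg : C → Ordinal.{t}} {M : Type w} [Category.{v} M]
  [HasColimitsOfSize.{u, u} M] {x : C}

/-- The coprojection `A_y ⟶ L_x A` at an arrow `g : y ⟶ x`. -/
noncomputable abbrev latchingι (A : C ⥤ M) {y : Below deg (deg x)} (g : y.obj ⟶ x) :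
    A.obj y.obj ⟶ latchingObj deg x A :=
  weightedColim.ι (homTo deg x (deg x)) (Below.ι deg (deg x) ⋙ A) (c := y) g

lemma map_latchingι (A : C ⥤ M) {y z : Below deg (deg x)} (k : y.obj ⟶ z.obj)
    (g : z.obj ⟶ x) : A.map k ≫ latchingι A g = latchingι A (k ≫ g) :=
  weightedColim.ι_w (homTo deg x (deg x)) (Below.ι deg (deg x) ⋙ A) (ObjectProperty.homMk k) g

lemma ι_latchingMap {A B : C ⥤ M} (f : A ⟶ B) {y : Below deg (deg x)} (g : y.obj ⟶ x) :
    latchingι A g ≫ latchingMap deg x f = f.app y.obj ≫ latchingι B g :=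
  weightedColim.ι_map _ _ _

variable {A B : C ⥤ M} {f : A ⟶ B} {E Z : M} {p : E ⟶ Z} {a : latchingObj deg x A ⟶ E}
  {b : latchingObj deg x B ⟶ Z}

variable (f p a b) in
/-- The components at `g : y ⟶ x` of the lifts in a commutative square from `latchingMap deg x f`
to `p`. -/
abbrev LatchingLift {y : Below deg (deg x)} (g : y.obj ⟶ x) : Type v :=
  { l : B.obj y.obj ⟶ E // f.app y.obj ≫ l = latchingι A g ≫ a ∧ l ≫ p = latchingι B g ≫ b }

namespace LatchingLift

variable {y : Below deg (deg x)}
  (s : ∀ z : Below deg (deg x), deg z.obj < deg y.obj → ∀ g : z.obj ⟶ x, LatchingLift f p a b g)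
  (hs : ∀ ⦃z z' : Below deg (deg x)⦄ (hz : deg z.obj < deg y.obj) (hz' : deg z'.obj < deg y.obj)
    (k : z ⟶ z') (g : z'.obj ⟶ x), B.map k.hom ≫ (s z' hz' g).1 = (s z hz (k.hom ≫ g)).1)

include hs

/-- The component at `k ≫ g` has to be `B k` followed by the component at `g`, and connectedness
makes it independent of the factorization. -/
lemma exists_extension_of_factorization
    (hconn : LowFactorizationsConnected deg (deg y.obj) y.obj x) {z : Below deg (deg x)}
    (hz : deg z.obj < deg y.obj) (k : y ⟶ z) (g : z.obj ⟶ x) :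
    ∃ l : LatchingLift f p a b (k.hom ≫ g),
      (∀ z' hz' (k' : z' ⟶ y), B.map k'.hom ≫ l.1 = (s z' hz' (k'.hom ≫ k.hom ≫ g)).1) ∧
      ∀ z' hz' (k' : y ⟶ z') (g' : z'.obj ⟶ x), k'.hom ≫ g' = k.hom ≫ g →
        B.map k'.hom ≫ (s z' hz' g').1 = l.1 := by
  refine ⟨⟨B.map k.hom ≫ (s z hz g).1, ?_, ?_⟩, fun z' hz' k' ↦ ?_, fun z' hz' k' g' e ↦ ?_⟩
  · rw [← f.naturality_assoc, (s z hz g).2.1, ← Category.assoc, map_latchingι]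
  · rw [Category.assoc, (s z hz g).2.2, ← Category.assoc, map_latchingι]
  · rw [← Category.assoc, ← B.map_comp, ← Category.assoc k'.hom]
    exact hs hz' hz (k' ≫ k) g
  · refine hconn.eq_of_comp_eq
      (fun w hw k g ↦ B.map k ≫ (s ⟨w, hw.trans y.property⟩ hw g).1)
      (fun w w' hw hw' k m g ↦ ?_) hz' hz k'.hom g' k.hom g e
    rw [B.map_comp, Category.assoc]
    exact congrArg (B.map k ≫ ·) (hs (z := ⟨w, hw.trans y.property⟩)
      (z' := ⟨w', hw'.trans y.property⟩) hw hw' (ObjectProperty.homMk m) g).symm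

lemma exists_extension_of_lift [HasPushouts M] [HasLiftingProperty (relLatching deg y.obj f) p]
    (sq : CommSq a (latchingMap deg x f) p b) (g : y.obj ⟶ x) :
    ∃ l : LatchingLift f p a b g,
      ∀ z hz (k : z ⟶ y), B.map k.hom ≫ l.1 = (s z hz (k.hom ≫ g)).1 := by
  let up (z : Below deg (deg y.obj)) : Below deg (deg x) := ⟨z.obj, z.property.trans y.property⟩
  let σ : latchingObj deg y.obj B ⟶ E :=
    weightedColim.desc _ _ (fun z k ↦ (s (up z) z.property (k ≫ g)).1) fun z z' k k' ↦
      (congrArg (fun h ↦ (s _ _ h).1) (Category.assoc _ _ _)).trans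
        (hs (z := up z) (z' := up z') z.property z'.property (ObjectProperty.homMk k.hom) _).symm
  have ι_σ {z : Below deg (deg y.obj)} (k : z.obj ⟶ y.obj) : latchingι B k ≫ σ =
      (s (up z) z.property (k ≫ g)).1 :=
    weightedColim.ι_desc _ _ _ _ _
  have hσ : latchingMap deg y.obj f ≫ σ = fromLatching deg y.obj A ≫ latchingι A g ≫ a :=
    weightedColim.hom_ext fun z (k : z.obj ⟶ y.obj) ↦ by
      rw [reassoc_of% ι_latchingMap, reassoc_of% ι_fromLatching, ι_σ,
        (s (up z) z.property (k ≫ g)).2.1, ← map_latchingι A (y := up z) k g, Category.assoc]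
  have sq' : CommSq (pushout.desc σ (latchingι A g ≫ a) hσ) (relLatching deg y.obj f) p
      (latchingι B g ≫ b) := by
    refine ⟨pushout.hom_ext (weightedColim.hom_ext fun z (k : z.obj ⟶ y.obj) ↦ ?_) ?_⟩
    · rw [pushout.inl_desc_assoc, reassoc_of% inl_relLatching deg y.obj f,
        reassoc_of% ι_fromLatching, reassoc_of% ι_σ, (s (up z) z.property (k ≫ g)).2.2,
        ← map_latchingι B (y := up z) k g, Category.assoc]
    · rw [pushout.inr_desc_assoc, reassoc_of% inr_relLatching deg y.obj f, Category.assoc, sq.w,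
        reassoc_of% ι_latchingMap]
  refine ⟨⟨sq'.lift, ?_, sq'.fac_right⟩, fun z hz k ↦ ?_⟩
  · rw [← inr_relLatching deg y.obj f, Category.assoc, sq'.fac_left, pushout.inr_desc]
  · rw [← ι_fromLatching deg y.obj B (y := ⟨z.obj, hz⟩) k.hom, ← inl_relLatching deg y.obj f]
    simp only [Category.assoc]
    rw [sq'.fac_left, pushout.inl_desc]
    exact ι_σ (z := ⟨z.obj, hz⟩) k.hom

/-- At an arrow that factors through an object of lower degree the component is forced; at any other
arrow it comes from a lift of the relative latching map. -/
lemma exists_extension [HasPushouts M] [HasLiftingProperty (relLatching deg y.obj f) p]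
    (hconn : LowFactorizationsConnected deg (deg y.obj) y.obj x)
    (sq : CommSq a (latchingMap deg x f) p b) (g : y.obj ⟶ x) :
    ∃ l : LatchingLift f p a b g,
      (∀ z hz (k : z ⟶ y), B.map k.hom ≫ l.1 = (s z hz (k.hom ≫ g)).1) ∧
      ∀ z hz (k : y ⟶ z) (g' : z.obj ⟶ x), k.hom ≫ g' = g →
        B.map k.hom ≫ (s z hz g').1 = l.1 := by
  by_cases hg : ∃ (z : Below deg (deg x)) (_ : deg z.obj < deg y.obj) (k : y ⟶ z)
    (g' : z.obj ⟶ x), k.hom ≫ g' = g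
  · obtain ⟨z, hz, k, g', rfl⟩ := hg
    obtain ⟨l, hl, hl'⟩ := exists_extension_of_factorization s hs hconn hz k g'
    exact ⟨l, fun z' hz' k' ↦ hl z' hz' k', hl'⟩
  · obtain ⟨l, hl⟩ := exists_extension_of_lift s hs sq g
    exact ⟨l, hl, fun z hz k g' e ↦ (hg ⟨z, hz, k, g', e⟩).elim⟩

end LatchingLift

theorem HasLowFactorizations.latchingMap_hasLiftingProperty [HasPushouts M]
    (hdeg : HasLowFactorizations deg)
    (hconn : ∀ y, deg y < deg x → LowFactorizationsConnected deg (deg y) y x)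
    (h : ∀ y, deg y < deg x → HasLiftingProperty (relLatching deg y f) p) :
    HasLiftingProperty (latchingMap deg x f) p where
  sq_hasLift {a b} sq := by
    obtain ⟨s, hs⟩ := (hdeg.below (deg x)).exists_compatible_family
      (Fib := fun y : Below deg (deg x) ↦ ∀ g : y.obj ⟶ x, LatchingLift f p a b g)
      (Compat := fun (y z : Below deg (deg x)) (k : y ⟶ z) l l' ↦
        ∀ g, B.map k.hom ≫ (l' g).1 = (l (k.hom ≫ g)).1)
      (fun y l g ↦ by
        rw [ObjectProperty.FullSubcategory.id_hom, Category.id_comp, B.map_id, Category.id_comp])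
      (fun y z z' k k' l l' l'' h h' g ↦ by
        rw [ObjectProperty.FullSubcategory.comp_hom, Category.assoc, B.map_comp, Category.assoc, h',
          h])
      (fun y s hs ↦ by
        have exists_lift (g : y.obj ⟶ x) :=
          have := h _ y.property
          LatchingLift.exists_extension s hs (hconn _ y.property) sq g
        choose l hl hl' using exists_lift
        exact ⟨l, fun z hz ↦ ⟨fun k g ↦ hl g z hz k, fun k g ↦ hl' _ z hz k g rfl⟩⟩)
    refine ⟨⟨{ l := weightedColim.desc _ _ (fun y g ↦ (s y g).1) fun y z k g ↦ (hs k g).symm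
               fac_left := weightedColim.hom_ext fun y g ↦ ?_
               fac_right := weightedColim.hom_ext fun y g ↦ ?_ }⟩⟩
    · rw [reassoc_of% ι_latchingMap, weightedColim.ι_desc]
      exact (s y g).2.1
    · rw [reassoc_of% weightedColim.ι_desc]
      exact (s y g).2.2

end LatchingMap

section MatchingMap

variable {C : Type u} [Category.{u} C] {deg : C → Ordinal.{t}} {M : Type w} [Category.{v} M]
  [HasLimitsOfSize.{u, u} M] {x : C}

/-- The projection `M_x A ⟶ A_y` at an arrow `g : x ⟶ y`. -/
noncomputable abbrev matchingπ (A : C ⥤ M) {y : Below deg (deg x)} (g : x ⟶ y.obj) :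
    matchingObj deg x A ⟶ A.obj y.obj :=
  (homFrom deg x (deg x)).weightedLimObjObjπ (Below.ι deg (deg x) ⋙ A) (j := y) g

lemma matchingπ_map (A : C ⥤ M) {y z : Below deg (deg x)} (g : x ⟶ y.obj) (k : y.obj ⟶ z.obj) :
    matchingπ A g ≫ A.map k = matchingπ A (g ≫ k) :=
  (homFrom deg x (deg x)).weightedLimObjObj_w (Below.ι deg (deg x) ⋙ A) (j₁ := y) g
    (ObjectProperty.homMk k)

lemma matchingMap_π {A B : C ⥤ M} (f : A ⟶ B) {y : Below deg (deg x)} (g : x ⟶ y.obj) :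
    matchingMap deg x f ≫ matchingπ B g = matchingπ A g ≫ f.app y.obj :=
  Functor.weightedLimObjMap_π _ _ _

variable {A B : C ⥤ M} {f : A ⟶ B} {Z E : M} {i : Z ⟶ E} {a : Z ⟶ matchingObj deg x A}
  {b : E ⟶ matchingObj deg x B}

variable (f i a b) in
/-- The components at `g : x ⟶ y` of the lifts in a commutative square from `i` to
`matchingMap deg x f`. -/
abbrev MatchingLift {y : Below deg (deg x)} (g : x ⟶ y.obj) : Type v :=
  { l : E ⟶ A.obj y.obj // i ≫ l = a ≫ matchingπ A g ∧ l ≫ f.app y.obj = b ≫ matchingπ B g }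

namespace MatchingLift

variable {y : Below deg (deg x)}
  (s : ∀ z : Below deg (deg x), deg z.obj < deg y.obj → ∀ g : x ⟶ z.obj, MatchingLift f i a b g)
  (hs : ∀ ⦃z z' : Below deg (deg x)⦄ (hz : deg z.obj < deg y.obj) (hz' : deg z'.obj < deg y.obj)
    (k : z ⟶ z') (g : x ⟶ z.obj), (s z hz g).1 ≫ A.map k.hom = (s z' hz' (g ≫ k.hom)).1)

include hs

/-- The component at `g ≫ k` has to be the component at `g` followed by `A k`, and connectedness
makes it independent of the factorization. -/
lemma exists_extension_of_factorization
    (hconn : LowFactorizationsConnected deg (deg y.obj) x y.obj) {z : Below deg (deg x)}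
    (hz : deg z.obj < deg y.obj) (g : x ⟶ z.obj) (k : z ⟶ y) :
    ∃ l : MatchingLift f i a b (g ≫ k.hom),
      (∀ z' hz' (k' : y ⟶ z'), l.1 ≫ A.map k'.hom = (s z' hz' ((g ≫ k.hom) ≫ k'.hom)).1) ∧
      ∀ z' hz' (g' : x ⟶ z'.obj) (k' : z' ⟶ y), g' ≫ k'.hom = g ≫ k.hom →
        (s z' hz' g').1 ≫ A.map k'.hom = l.1 := by
  refine ⟨⟨(s z hz g).1 ≫ A.map k.hom, ?_, ?_⟩, fun z' hz' k' ↦ ?_, fun z' hz' g' k' e ↦ ?_⟩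
  · rw [← Category.assoc, (s z hz g).2.1, Category.assoc, matchingπ_map]
  · rw [Category.assoc, f.naturality, ← Category.assoc, (s z hz g).2.2, Category.assoc,
      matchingπ_map]
  · rw [Category.assoc, ← A.map_comp, Category.assoc]
    exact hs hz hz' (k ≫ k') g
  · refine hconn.eq_of_comp_eq
      (fun w hw g k ↦ (s ⟨w, hw.trans y.property⟩ hw g).1 ≫ A.map k)
      (fun w w' hw hw' g m k ↦ ?_) hz' hz g' k'.hom g k.hom e
    rw [A.map_comp, ← Category.assoc]
    exact congrArg (· ≫ A.map k) (hs (z := ⟨w, hw.trans y.property⟩)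
      (z' := ⟨w', hw'.trans y.property⟩) hw hw' (ObjectProperty.homMk m) g)

lemma exists_extension_of_lift [HasPullbacks M] [HasLiftingProperty i (relMatching deg y.obj f)]
    (sq : CommSq a i (matchingMap deg x f) b) (g : x ⟶ y.obj) :
    ∃ l : MatchingLift f i a b g,
      ∀ z hz (k : y ⟶ z), l.1 ≫ A.map k.hom = (s z hz (g ≫ k.hom)).1 := by
  let up (z : Below deg (deg y.obj)) : Below deg (deg x) := ⟨z.obj, z.property.trans y.property⟩
  let σ : E ⟶ matchingObj deg y.obj A :=
    weightedLimLift _ _ (fun z k ↦ (s (up z) z.property (g ≫ k)).1) fun z z' k k' ↦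
      (hs (z := up z) (z' := up z') z.property z'.property (ObjectProperty.homMk k.hom) _).trans
        (congrArg (fun h ↦ (s _ _ h).1) (Category.assoc _ _ _))
  have σ_π {z : Below deg (deg y.obj)} (k : y.obj ⟶ z.obj) : σ ≫ matchingπ A k =
      (s (up z) z.property (g ≫ k)).1 :=
    weightedLimLift_π _ _ _ _ _
  have hσ : σ ≫ matchingMap deg y.obj f = (b ≫ matchingπ B g) ≫ toMatching deg y.obj B :=
    Functor.weightedLimObjObj.hom_ext fun {z} (k : y.obj ⟶ z.obj) ↦ by
      rw [Category.assoc, Category.assoc, Category.assoc, matchingMap_π, toMatching_π,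
        reassoc_of% σ_π, (s (up z) z.property (g ≫ k)).2.2, ← matchingπ_map B (z := up z) g k]
  have sq' : CommSq (a ≫ matchingπ A g) i (relMatching deg y.obj f)
      (pullback.lift σ (b ≫ matchingπ B g) hσ) := by
    refine ⟨pullback.hom_ext
      (Functor.weightedLimObjObj.hom_ext fun {z} (k : y.obj ⟶ z.obj) ↦ ?_) ?_⟩
    · simp only [Category.assoc]
      rw [reassoc_of% relMatching_fst deg y.obj f, toMatching_π, pullback.lift_fst_assoc, σ_π,
        (s (up z) z.property (g ≫ k)).2.1, ← matchingπ_map A (z := up z) g k]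
    · rw [Category.assoc, Category.assoc, Category.assoc, pullback.lift_snd, relMatching_snd,
        ← reassoc_of% sq.w, matchingMap_π]
  refine ⟨⟨sq'.lift, sq'.fac_left, ?_⟩, fun z hz k ↦ ?_⟩
  · rw [← relMatching_snd deg y.obj f, reassoc_of% sq'.fac_right, pullback.lift_snd]
  · rw [← toMatching_π deg y.obj A (y := ⟨z.obj, hz⟩) k.hom, ← relMatching_fst deg y.obj f,
      Category.assoc, reassoc_of% sq'.fac_right, reassoc_of% pullback.lift_fst]
    exact σ_π (z := ⟨z.obj, hz⟩) k.hom

/-- At an arrow that factors through an object of lower degree the component is forced; at any other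
arrow it comes from a lift of the relative matching map. -/
lemma exists_extension [HasPullbacks M] [HasLiftingProperty i (relMatching deg y.obj f)]
    (hconn : LowFactorizationsConnected deg (deg y.obj) x y.obj)
    (sq : CommSq a i (matchingMap deg x f) b) (g : x ⟶ y.obj) :
    ∃ l : MatchingLift f i a b g,
      (∀ z hz (k : y ⟶ z), l.1 ≫ A.map k.hom = (s z hz (g ≫ k.hom)).1) ∧
      ∀ z hz (g' : x ⟶ z.obj) (k : z ⟶ y), g' ≫ k.hom = g →
        (s z hz g').1 ≫ A.map k.hom = l.1 := by
  by_cases hg : ∃ (z : Below deg (deg x)) (_ : deg z.obj < deg y.obj) (g' : x ⟶ z.obj)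
    (k : z ⟶ y), g' ≫ k.hom = g
  · obtain ⟨z, hz, g', k, rfl⟩ := hg
    exact exists_extension_of_factorization s hs hconn hz g' k
  · obtain ⟨l, hl⟩ := exists_extension_of_lift s hs sq g
    exact ⟨l, hl, fun z hz g' k e ↦ (hg ⟨z, hz, g', k, e⟩).elim⟩

end MatchingLift

theorem HasLowFactorizations.matchingMap_hasLiftingProperty [HasPullbacks M]
    (hdeg : HasLowFactorizations deg)
    (hconn : ∀ y, deg y < deg x → LowFactorizationsConnected deg (deg y) x y)
    (h : ∀ y, deg y < deg x → HasLiftingProperty i (relMatching deg y f)) :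
    HasLiftingProperty i (matchingMap deg x f) where
  sq_hasLift {a b} sq := by
    obtain ⟨s, hs⟩ := (hdeg.below (deg x)).exists_compatible_family
      (Fib := fun y : Below deg (deg x) ↦ ∀ g : x ⟶ y.obj, MatchingLift f i a b g)
      (Compat := fun (y z : Below deg (deg x)) (k : y ⟶ z) l l' ↦
        ∀ g, (l g).1 ≫ A.map k.hom = (l' (g ≫ k.hom)).1)
      (fun y l g ↦ by
        rw [ObjectProperty.FullSubcategory.id_hom, Category.comp_id, A.map_id, Category.comp_id])
      (fun y z z' k k' l l' l'' h h' g ↦ by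
        rw [ObjectProperty.FullSubcategory.comp_hom, ← Category.assoc, A.map_comp, ← Category.assoc,
          h, h'])
      (fun y s hs ↦ by
        have exists_lift (g : x ⟶ y.obj) :=
          have := h _ y.property
          MatchingLift.exists_extension s hs (hconn _ y.property) sq g
        choose l hl hl' using exists_lift
        exact ⟨l, fun z hz ↦ ⟨fun k g ↦ hl' _ z hz g k rfl, fun k g ↦ hl g z hz k⟩⟩)
    refine ⟨⟨{ l := weightedLimLift _ _ (fun y g ↦ (s y g).1) fun y z k g ↦ hs k g
               fac_left := Functor.weightedLimObjObj.hom_ext fun {y} g ↦ ?_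
               fac_right := Functor.weightedLimObjObj.hom_ext fun {y} g ↦ ?_ }⟩⟩
    · rw [Category.assoc, weightedLimLift_π]
      exact (s y g).2.1
    · rw [Category.assoc, matchingMap_π, reassoc_of% weightedLimLift_π]
      exact (s y g).2.2

end MatchingMap

section WeakEquivalences

variable {C : Type u} [Category.{u} C] {deg : C → Ordinal.{t}} {M : Type w} [Category.{v} M]
  [ModelCategory M] {A B : C ⥤ M} (f : A ⟶ B)

namespace IsAlmostReedy

variable (hC : IsAlmostReedy deg)

include hC

section Latching

variable [HasColimitsOfSize.{u, u} M]

lemma trivialCofibrations_latchingMap {x : C}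
    (h : ∀ y, deg y < deg x → trivialCofibrations M (relLatching deg y f)) :
    trivialCofibrations M (latchingMap deg x f) := by
  rw [← MorphismProperty.llp_eq_of_wfs (trivialCofibrations M) (fibrations M)]
  exact fun _ _ p hp ↦ hC.bistratified.hasLowFactorizations.latchingMap_hasLiftingProperty
    (fun y hy ↦ hC.lowFactorizationsConnected_of_gt hy)
    fun y hy ↦ MorphismProperty.hasLiftingProperty_of_wfs _ _ (h y hy) hp

theorem reedyLeft_trivialCofibrations_iff :
    reedyLeft deg (trivialCofibrations M) f ↔
      reedyLeft deg (cofibrations M) f ∧ ∀ x, weakEquivalences M (f.app x) := by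
  have weakEquivalence_inr {x : C}
      (h : ∀ y, deg y < deg x → trivialCofibrations M (relLatching deg y f)) :
      WeakEquivalence (pushout.inr (latchingMap deg x f) (fromLatching deg x A)) := by
    obtain ⟨_, _⟩ := (mem_trivialCofibrations_iff _).1 (hC.trivialCofibrations_latchingMap f h)
    infer_instance
  refine ⟨fun h ↦ ⟨fun x ↦ (h x).1, fun x ↦ ?_⟩, fun ⟨h, hw⟩ x ↦ ?_⟩
  · have := weakEquivalence_inr (x := x) fun y _ ↦ h y
    have : WeakEquivalence (relLatching deg x f) := ⟨(h x).2⟩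
    rw [← weakEquivalence_iff, ← inr_relLatching deg x f]
    infer_instance
  · induction x using (InvImage.wf deg wellFounded_lt).induction with
    | _ x ih =>
      have := weakEquivalence_inr ih
      have : WeakEquivalence (f.app x) := ⟨hw x⟩
      exact ⟨h x, (weakEquivalence_of_precomp_of_fac (inr_relLatching deg x f)).mem⟩

end Latching

section Matching

variable [HasLimitsOfSize.{u, u} M]

lemma trivialFibrations_matchingMap {x : C}
    (h : ∀ y, deg y < deg x → trivialFibrations M (relMatching deg y f)) :
    trivialFibrations M (matchingMap deg x f) := by
  rw [← MorphismProperty.rlp_eq_of_wfs (cofibrations M) (trivialFibrations M)]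
  exact fun _ _ i hi ↦ hC.bistratified.hasLowFactorizations.matchingMap_hasLiftingProperty
    (fun y hy ↦ hC.lowFactorizationsConnected_of_lt hy)
    fun y hy ↦ MorphismProperty.hasLiftingProperty_of_wfs _ _ hi (h y hy)

theorem reedyRight_trivialFibrations_iff :
    reedyRight deg (trivialFibrations M) f ↔
      reedyRight deg (fibrations M) f ∧ ∀ x, weakEquivalences M (f.app x) := by
  have weakEquivalence_snd {x : C}
      (h : ∀ y, deg y < deg x → trivialFibrations M (relMatching deg y f)) :
      WeakEquivalence (pullback.snd (matchingMap deg x f) (toMatching deg x B)) := by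
    obtain ⟨_, _⟩ := (mem_trivialFibrations_iff _).1 (hC.trivialFibrations_matchingMap f h)
    infer_instance
  refine ⟨fun h ↦ ⟨fun x ↦ (h x).1, fun x ↦ ?_⟩, fun ⟨h, hw⟩ x ↦ ?_⟩
  · have := weakEquivalence_snd (x := x) fun y _ ↦ h y
    have : WeakEquivalence (relMatching deg x f) := ⟨(h x).2⟩
    rw [← weakEquivalence_iff, ← relMatching_snd deg x f]
    infer_instance
  · induction x using (InvImage.wf deg wellFounded_lt).induction with
    | _ x ih =>
      have := weakEquivalence_snd ih
      have : WeakEquivalence (f.app x) := ⟨hw x⟩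
      exact ⟨h x, (weakEquivalence_of_postcomp_of_fac (relMatching_snd deg x f)).mem⟩

end Matching

end IsAlmostReedy

variable (C M) in
/-- The weak equivalences of the Reedy model structure. -/
def levelwiseWeakEquivalences : MorphismProperty (C ⥤ M) :=
  fun _ _ f ↦ ∀ x : C, weakEquivalences M (f.app x)

instance : (levelwiseWeakEquivalences C M).HasTwoOutOfThreeProperty where
  comp_mem _ _ hf hg x := (weakEquivalences M).comp_mem _ _ (hf x) (hg x)
  of_postcomp _ _ hg hfg x := (weakEquivalences M).of_postcomp _ _ (hg x) (hfg x)
  of_precomp _ _ hf hfg x := (weakEquivalences M).of_precomp _ _ (hf x) (hfg x)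

end WeakEquivalences

theorem mainTheorem2 {C : Type u} [Category.{u} C] (deg : C → Ordinal.{t})
    (hC : IsAlmostReedy deg)
    (M : Type w) [Category.{v} M] [HasLimitsOfSize.{u, u} M] [HasColimitsOfSize.{u, u} M]
    [ModelCategory M] :
    ∃ _ : ModelCategory (C ⥤ M),
      (∀ ⦃A B : C ⥤ M⦄ (f : A ⟶ B),
        weakEquivalences (C ⥤ M) f ↔ ∀ x : C, weakEquivalences M (f.app x)) ∧
      (∀ ⦃A B : C ⥤ M⦄ (f : A ⟶ B),
        fibrations (C ⥤ M) f ↔ ∀ x : C, fibrations M (relMatching deg x f)) ∧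
      (∀ ⦃A B : C ⥤ M⦄ (f : A ⟶ B),
        trivialFibrations (C ⥤ M) f ↔ ∀ x : C, trivialFibrations M (relMatching deg x f)) ∧
      (∀ ⦃A B : C ⥤ M⦄ (f : A ⟶ B),
        cofibrations (C ⥤ M) f ↔ ∀ x : C, cofibrations M (relLatching deg x f)) ∧
      (∀ ⦃A B : C ⥤ M⦄ (f : A ⟶ B),
        trivialCofibrations (C ⥤ M) f ↔ ∀ x : C, trivialCofibrations M (relLatching deg x f)) := by
  let : CategoryWithFibrations (C ⥤ M) := ⟨reedyRight deg (fibrations M)⟩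
  let : CategoryWithCofibrations (C ⥤ M) := ⟨reedyLeft deg (cofibrations M)⟩
  let : CategoryWithWeakEquivalences (C ⥤ M) := ⟨levelwiseWeakEquivalences C M⟩
  have hcof : trivialCofibrations (C ⥤ M) = reedyLeft deg (trivialCofibrations M) := by
    ext A B f
    exact (hC.reedyLeft_trivialCofibrations_iff f).symm
  have hfib : trivialFibrations (C ⥤ M) = reedyRight deg (trivialFibrations M) := by
    ext A B f
    exact (hC.reedyRight_trivialFibrations_iff f).symm
  have : (weakEquivalences (C ⥤ M)).HasTwoOutOfThreeProperty :=
    inferInstanceAs (levelwiseWeakEquivalences C M).HasTwoOutOfThreeProperty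
  have : (cofibrations (C ⥤ M)).IsWeakFactorizationSystem (trivialFibrations (C ⥤ M)) := by
    rw [hfib]
    exact hC.bistratified.isWeakFactorizationSystem (cofibrations M) (trivialFibrations M)
  have : (trivialCofibrations (C ⥤ M)).IsWeakFactorizationSystem (fibrations (C ⥤ M)) := by
    rw [hcof]
    exact hC.bistratified.isWeakFactorizationSystem (trivialCofibrations M) (fibrations M)
  refine ⟨ModelCategory.mk' (C ⥤ M), fun _ _ _ ↦ Iff.rfl, fun _ _ _ ↦ Iff.rfl, fun _ _ f ↦ ?_,
    fun _ _ _ ↦ Iff.rfl, fun _ _ f ↦ ?_⟩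
  · exact (hC.reedyRight_trivialFibrations_iff f).symm
  · exact (hC.reedyLeft_trivialCofibrations_iff f).symm
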